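/- Let $m\ge 4$ and consider the cumulative link model with two predictors, three ordered response categories, link $g$ and parameters $\beta\in\mathbb R^2$, $\theta_1,\theta_2$, at $m$ distinct design points $x_i=(x_{i1},x_{i2})\in\mathbb R^2$: $g(\gamma_{ij})=\theta_j-x_i^T\beta$ with $\gamma_{ij}\in(0,1)$, $j=1,2$. Here $g$ is differentiable on $(0,1)$ with $g'>0$, and with $\gamma_{i0}=0$, $\gamma_{i3}=1$ the category probabilities $\pi_{ij}=\gamma_{ij}-\gamma_{i,j-1}$ satisfy $0<\pi_{ij}<1$ ($j=1,2,3$). Assume that the $m\times 3$ matrix $\mathbf X_1$ with rows $(1,x_{i1},x_{i2})$ has rank $3$, and let $|\mathbf X_1[j,k,s]|$ be the determinant of the matrix whose rows are the rows $j,k,s$ of $\mathbf X_1$, in this order. A design is $\mathbf p=(p_1,\dots,p_m)$ with $p_i\ge0$, $\sum_i p_i=1$; it is D-optimal if it maximizes, among all designs, $\det\sum_i p_i\mathbf A_i$, where $\mathbf A_i$ is the Fisher information matrix for $(\beta_1,\beta_2,\theta_1,\theta_2)$ of one observation at $x_i$. Put $g_{ij}=(g^{-1})'(\theta_j-x_i^T\beta)$,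 $u_{i1}=g_{i1}^2(\pi_{i1}^{-1}+\pi_{i2}^{-1})$, $u_{i2}=g_{i2}^2(\pi_{i2}^{-1}+\pi_{i3}^{-1})$, $b_{i2}=g_{i1}g_{i2}\pi_{i2}^{-1}$, $e_i=u_{i1}+u_{i2}-2b_{i2}$, $w_i=e_i^{-1}g_{i1}^2g_{i2}^2(\pi_{i1}\pi_{i2}\pi_{i3})^{-1}$. Then a design $\mathbf p=(p_1^*,p_2^*,p_3^*,0,\dots,0)$ supported on the first three points is D-optimal if and only if both of the following hold. (1) For some simultaneous renumbering of the pairs $(w_1,p_1^*),(w_2,p_2^*),(w_3,p_3^*)$ for which $w_1\ge w_2\ge w_3$, one of these cases holds: (i) $w_1\ge w_2=w_3$, $p_1^*=\frac{\Delta_1}{4w_1+\Delta_1}$, $p_2^*=p_3^*=\frac{2w_1}{4w_1+\Delta_1}$, where $\Delta_1=2w_1-3w_2+\sqrt{4w_1^2-4w_1w_2+9w_2^2}$; (ii) $w_1=w_2>w_3$, $p_1^*=p_2^*=\frac{\Delta_2}{2(\Delta_2+2w_1)}$, $p_3^*=\frac{2w_1}{\Delta_2+2w_1}$, where $\Delta_2=3w_1-2w_3+\sqrt{9w_1^2-4w_1w_3+4w_3^2}$;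 (iii) $w_1>w_2>w_3$, $p_1^*=\frac{y_1}{y_1+y_2+1}$, $p_2^*=\frac{y_2}{y_1+y_2+1}$, $p_3^*=\frac1{y_1+y_2+1}$, where $$y_1=-\frac{b_2}{3}-\frac{2^{1/3}(3b_1-b_2^2)}{3A^{1/3}}+\frac{A^{1/3}}{3\cdot2^{1/3}},\qquad y_2=\frac{(w_1-w_3)y_1}{(w_2-w_3)+(w_1-w_2)y_1},$$ $A=-27b_0+9b_1b_2-2b_2^3+3^{3/2}(27b_0^2+4b_1^3-18b_0b_1b_2-b_1^2b_2^2+4b_0b_2^3)^{1/2}$ (complex arithmetic, principal values of the roots), $b_i=c_i/c_3$ for $i=0,1,2$, and $c_0=w_3(w_2-w_3)$, $c_1=3w_1w_2-w_1w_3-4w_2w_3+2w_3^2$, $c_2=2w_1^2-4w_1w_2-w_1w_3+3w_2w_3$, $c_3=w_1(w_2-w_1)$. (2) In the original numbering, for every $i=4,\dots,m$, $$|\mathbf X_1[1,2,i]|^2e_1e_2e_ip_1^*p_2^*(w_1p_1^*+w_2p_2^*)+|\mathbf X_1[1,3,i]|^2e_1e_3e_ip_1^*p_3^*(w_1p_1^*+w_3p_3^*)$$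 $$+|\mathbf X_1[2,3,i]|^2e_2e_3e_ip_2^*p_3^*(w_2p_2^*+w_3p_3^*)+D_ip_1^*p_2^*p_3^*\le|\mathbf X_1[1,2,3]|^2e_1e_2e_3p_2^*p_3^*(2w_1p_1^*+w_2p_2^*+w_3p_3^*),$$ where $D_i=\sum_{(j,k,s,t)\in E_i}e_je_k(u_{s1}u_{t2}+u_{s2}u_{t1}-2b_{s2}b_{t2})\,|\mathbf X_1[j,k,s]|\,|\mathbf X_1[j,k,t]|$ and $E_i=\{(1,2,3,i),(1,3,2,i),(1,i,2,3),(2,3,1,i),(2,i,1,3),(3,i,1,2)\}$. -/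

import Mathlib

open Set

noncomputable section

namespace CumulativeLink

/-- The inverse `g⁻¹` of a link function `g : (0, 1) → ℝ` (meaningful on the range of `g`). -/
def invLink (g : ℝ → ℝ) : ℝ → ℝ := Function.invFunOn g (Ioo 0 1)

/-- `θ_j - xᵀβ`, where the parameter vector `ψ = (β₁, β₂, θ₁, θ₂)` is indexed by
`Fin 2 ⊕ Fin 2`. -/
def linPred (ψ : Fin 2 ⊕ Fin 2 → ℝ) (x : Fin 2 → ℝ) (j : Fin 2) : ℝ :=
  ψ (Sum.inr j) - ∑ s, x s * ψ (Sum.inl s)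

/-- Cumulative probabilities `γ₀ = 0, γ₁, γ₂, γ₃ = 1` of the response at the design point `x`. -/
def cumProb (g : ℝ → ℝ) (ψ : Fin 2 ⊕ Fin 2 → ℝ) (x : Fin 2 → ℝ) : Fin 4 → ℝ :=
  ![0, invLink g (linPred ψ x 0), invLink g (linPred ψ x 1), 1]

/-- Probabilities of the three ordered categories (category `j + 1` in one-based numbering). -/
def catProb (g : ℝ → ℝ) (ψ : Fin 2 ⊕ Fin 2 → ℝ) (x : Fin 2 → ℝ) (j : Fin 3) : ℝ :=
  cumProb g ψ x j.succ - cumProb g ψ x j.castSucc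

/-- Score of one observation in category `j` at `x`: partial derivative of its log-likelihood
with respect to the parameter with index `s`. -/
def score (g : ℝ → ℝ) (ψ : Fin 2 ⊕ Fin 2 → ℝ) (x : Fin 2 → ℝ) (j : Fin 3)
    (s : Fin 2 ⊕ Fin 2) : ℝ :=
  deriv (fun r => Real.log (catProb g (Function.update ψ s r) x j)) (ψ s)

/-- Fisher information of one observation at `x`: the expectation of the product of scores. -/
def pointInfo (g : ℝ → ℝ) (ψ : Fin 2 ⊕ Fin 2 → ℝ) (x : Fin 2 → ℝ) :
    Matrix (Fin 2 ⊕ Fin 2) (Fin 2 ⊕ Fin 2) ℝ :=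
  Matrix.of fun s t => ∑ j, catProb g ψ x j * (score g ψ x j s * score g ψ x j t)

/-- The data of a cumulative link model with two predictors, three ordered categories and
`m` design points: link, parameters `β`, `θ`, and design points `x`. -/
structure Model (m : ℕ) where
  link : ℝ → ℝ
  β : Fin 2 → ℝ
  θ : Fin 2 → ℝ
  x : Fin m → Fin 2 → ℝ

namespace Model

variable {m : ℕ} (M : Model m)

/-- The parameter vector `(β₁, β₂, θ₁, θ₂)`. -/
def param : Fin 2 ⊕ Fin 2 → ℝ := Sum.elim M.β M.θ

/-- The model equations make sense: every `θ_j - x_iᵀβ` is a value `g(γ)` with `0 < γ < 1`. -/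
def WellPosed : Prop :=
  ∀ i j, ∃ γ ∈ Ioo (0 : ℝ) 1, M.link γ = linPred M.param (M.x i) j

/-- `π_{i,j+1}`. -/
def π (i : Fin m) (j : Fin 3) : ℝ := catProb M.link M.param (M.x i) j

/-- `g_{i,j+1} = (g⁻¹)'(θ_{j+1} - x_iᵀβ)`. -/
def gd (i : Fin m) (j : Fin 2) : ℝ := deriv (invLink M.link) (linPred M.param (M.x i) j)

/-- `u_{i1}` -/
def u₁ (i : Fin m) : ℝ := M.gd i 0 ^ 2 * ((M.π i 0)⁻¹ + (M.π i 1)⁻¹)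

/-- `u_{i2}` -/
def u₂ (i : Fin m) : ℝ := M.gd i 1 ^ 2 * ((M.π i 1)⁻¹ + (M.π i 2)⁻¹)

/-- `b_{i2}` -/
def b₂ (i : Fin m) : ℝ := M.gd i 0 * M.gd i 1 * (M.π i 1)⁻¹

def e (i : Fin m) : ℝ := M.u₁ i + M.u₂ i - 2 * M.b₂ i

def w (i : Fin m) : ℝ :=
  (M.e i)⁻¹ * M.gd i 0 ^ 2 * M.gd i 1 ^ 2 * (M.π i 0 * M.π i 1 * M.π i 2)⁻¹

/-- The extended design matrix `(1 X)`. -/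
def X₁ : Matrix (Fin m) (Fin 3) ℝ := Matrix.of fun i => ![1, M.x i 0, M.x i 1]

/-- The (signed) determinant of the rows `i, j, k` of `X₁`, taken in this order. -/
def minor (i j k : Fin m) : ℝ := (M.X₁.submatrix ![i, j, k] id).det

/-- The summand of `D` that belongs to the quadruple `(j, k, s, t)`. -/
def Dterm (j k s t : Fin m) : ℝ :=
  M.e j * M.e k * (M.u₁ s * M.u₂ t + M.u₂ s * M.u₁ t - 2 * M.b₂ s * M.b₂ t)
    * M.minor j k s * M.minor j k t

/-- The coefficient `D_i`, for the points `a, b, c` (numbered `1, 2, 3`) and `i`. -/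
def D (a b c i : Fin m) : ℝ :=
  M.Dterm a b c i + M.Dterm a c b i + M.Dterm a i b c
    + M.Dterm b c a i + M.Dterm b i a c + M.Dterm c i a b

/-- Normalized Fisher information matrix of the approximate design `p`. -/
def fisherInfo (p : Fin m → ℝ) : Matrix (Fin 2 ⊕ Fin 2) (Fin 2 ⊕ Fin 2) ℝ :=
  ∑ i, p i • pointInfo M.link M.param (M.x i)

/-- `p` is an allocation that maximizes the determinant of the Fisher information matrix. -/
def IsDOptimal (p : Fin m → ℝ) : Prop :=
  p ∈ stdSimplex ℝ (Fin m) ∧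
    ∀ q ∈ stdSimplex ℝ (Fin m), (M.fisherInfo q).det ≤ (M.fisherInfo p).det

end Model

/-- The root of the cubic `c₀ + c₁ y + c₂ y² + c₃ y³` given by Cardano's formula. The operations
are those of complex numbers, with principal values of the roots. -/
def cardanoY (w₁ w₂ w₃ : ℝ) : ℂ :=
  let c₀ : ℝ := w₃ * (w₂ - w₃)
  let c₁ : ℝ := 3 * w₁ * w₂ - w₁ * w₃ - 4 * w₂ * w₃ + 2 * w₃ ^ 2
  let c₂ : ℝ := 2 * w₁ ^ 2 - 4 * w₁ * w₂ - w₁ * w₃ + 3 * w₂ * w₃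
  let c₃ : ℝ := w₁ * (w₂ - w₁)
  let b₀ : ℝ := c₀ / c₃
  let b₁ : ℝ := c₁ / c₃
  let b₂ : ℝ := c₂ / c₃
  let R : ℝ := 27 * b₀ ^ 2 + 4 * b₁ ^ 3 - 18 * b₀ * b₁ * b₂ - b₁ ^ 2 * b₂ ^ 2 + 4 * b₀ * b₂ ^ 3
  let A : ℂ := ((-27 * b₀ + 9 * b₁ * b₂ - 2 * b₂ ^ 3 : ℝ) : ℂ)
    + (3 : ℂ) ^ (3 / 2 : ℂ) * (R : ℂ) ^ (1 / 2 : ℂ)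
  let y : ℂ := -(b₂ : ℂ) / 3 - (2 : ℂ) ^ (1 / 3 : ℂ) * ((3 * b₁ - b₂ ^ 2 : ℝ) : ℂ) / (3 * A ^ (1 / 3 : ℂ))
    + A ^ (1 / 3 : ℂ) / (3 * (2 : ℂ) ^ (1 / 3 : ℂ))
  y

/-- `(p₁, p₂, p₃)` is the analytic three-point allocation for weights `w₁ ≥ w₂ ≥ w₃`. -/
def IsOrderedSolution (w₁ w₂ w₃ p₁ p₂ p₃ : ℝ) : Prop :=
  (w₁ ≥ w₂ ∧ w₂ = w₃ ∧
    let Δ := 2 * w₁ - 3 * w₂ + Real.sqrt (4 * w₁ ^ 2 - 4 * w₁ * w₂ + 9 * w₂ ^ 2)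
    p₁ = Δ / (4 * w₁ + Δ) ∧ p₂ = 2 * w₁ / (4 * w₁ + Δ) ∧ p₃ = 2 * w₁ / (4 * w₁ + Δ)) ∨
  (w₁ = w₂ ∧ w₂ > w₃ ∧
    let Δ := 3 * w₁ - 2 * w₃ + Real.sqrt (9 * w₁ ^ 2 - 4 * w₁ * w₃ + 4 * w₃ ^ 2)
    p₁ = Δ / (2 * (Δ + 2 * w₁)) ∧ p₂ = Δ / (2 * (Δ + 2 * w₁)) ∧ p₃ = 2 * w₁ / (Δ + 2 * w₁)) ∨
  (w₁ > w₂ ∧ w₂ > w₃ ∧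
    let y₁ : ℂ := cardanoY w₁ w₂ w₃
    let y₂ : ℂ := ((w₁ - w₃ : ℝ) : ℂ) * y₁ / (((w₂ - w₃ : ℝ) : ℂ) + ((w₁ - w₂ : ℝ) : ℂ) * y₁)
    (p₁ : ℂ) = y₁ / (y₁ + y₂ + 1) ∧ (p₂ : ℂ) = y₂ / (y₁ + y₂ + 1) ∧
      (p₃ : ℂ) = 1 / (y₁ + y₂ + 1))

/-- `p` is the analytic three-point allocation for the weights `w`, after renumbering the three
points so that the weights are in decreasing order. -/
def IsThreePointSolution (w p : Fin 3 → ℝ) : Prop :=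
  ∃ σ : Equiv.Perm (Fin 3),
    IsOrderedSolution (w (σ 0)) (w (σ 1)) (w (σ 2)) (p (σ 0)) (p (σ 1)) (p (σ 2))

end CumulativeLink

end

open Set

noncomputable section

namespace CumulativeLink

/-! The log-determinant is concave, so a nonsingular design `p` is D-optimal exactly when no move
toward a one-point design increases the determinant to first order: tr(M⁻¹Aᵢ) ≤ 4 for every i, where
M is the information matrix of `p` (`isDOptimal_iff_trace_le`). The number det M · tr(M⁻¹Aᵢ) is the
linear coefficient of det(M + tAᵢ).

In the coordinates (θ₁, -β, θ₂ - θ₁) the information matrix is bordered, with blocks G = ∑ p e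
x̃x̃ᵀ, v = ∑ p f x̃ and c = ∑ p u₂, where x̃ = (1, x). Its determinant c det G - vᵀ adj(G) v expands
by Cauchy-Binet into minors of `X₁`, and e w = e u₂ - f² brings in the weights w. This gives
`detThree` and `detCoeff` (`exists_det_fisherInfo_add_smul`).

At the three support points the inequalities add up to an equality, so each is an equality:
p₁p₂p₃(w₁p₁ + w₂p₂ + w₃p₃) is stationary on the simplex. Two equal weights leave a quadratic.
Distinct weights leave a cubic with three real roots, exactly one of them positive, and Cardano's
formula with principal values selects that root (`exists_cardanoY_eq`).

At the other points the inequality is condition (2), whose right side is 4 det M by stationarity.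
Collinear support points cannot satisfy (2): the right side vanishes while some `detCoeff` is
positive (`detCoeff_pos_of_minor_eq_zero`). -/

/-! ### Differentiability of the inverse link. -/

theorem strictMonoOn_link {g : ℝ → ℝ}
    (hg : ∀ γ ∈ Ioo (0 : ℝ) 1, DifferentiableAt ℝ g γ ∧ 0 < deriv g γ) :
    StrictMonoOn g (Ioo 0 1) := by
  refine strictMonoOn_of_deriv_pos (convex_Ioo 0 1)
    (fun γ hγ => (hg γ hγ).1.continuousAt.continuousWithinAt) ?_
  rw [interior_Ioo]
  exact fun γ hγ => (hg γ hγ).2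

theorem invLink_apply {g : ℝ → ℝ}
    (hg : ∀ γ ∈ Ioo (0 : ℝ) 1, DifferentiableAt ℝ g γ ∧ 0 < deriv g γ)
    {γ : ℝ} (hγ : γ ∈ Ioo (0 : ℝ) 1) : invLink g (g γ) = γ :=
  (strictMonoOn_link hg).injOn.leftInvOn_invFunOn hγ

/-- `invLink` is uncontrolled off the range of `g`. These neighbourhoods give both its continuity at
`g γ` and the local inverse identity required by the inverse function rule. -/
theorem image_link_mem_nhds {g : ℝ → ℝ}
    (hg : ∀ γ ∈ Ioo (0 : ℝ) 1, DifferentiableAt ℝ g γ ∧ 0 < deriv g γ)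
    {γ : ℝ} (hγ : γ ∈ Ioo (0 : ℝ) 1) {l r : ℝ} (hl : l ∈ Ico 0 γ) (hr : r ∈ Ioc γ 1) :
    g '' Ioo l r ∈ nhds (g γ) := by
  have hmono := strictMonoOn_link hg
  have h1 : (l + γ) / 2 ∈ Ioo (0 : ℝ) 1 := ⟨by linarith [hl.1, hγ.1], by linarith [hl.2, hγ.2]⟩
  have h2 : (γ + r) / 2 ∈ Ioo (0 : ℝ) 1 := ⟨by linarith [hr.1, hγ.1], by linarith [hr.2, hγ.2]⟩
  have hsub : Icc ((l + γ) / 2) ((γ + r) / 2) ⊆ Ioo 0 1 := fun y hy =>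
    ⟨h1.1.trans_le hy.1, hy.2.trans_lt h2.2⟩
  have hcont : ContinuousOn g (Icc ((l + γ) / 2) ((γ + r) / 2)) := fun y hy =>
    (hg y (hsub hy)).1.continuousAt.continuousWithinAt
  have hivt := intermediate_value_Icc (by linarith [hl.2, hr.1]) hcont
  refine Filter.mem_of_superset (Icc_mem_nhds (hmono h1 hγ (by linarith [hl.2]))
    (hmono hγ h2 (by linarith [hr.1]))) (hivt.trans (image_mono fun y hy => ?_))
  exact ⟨by linarith [hy.1, hl.2], by linarith [hy.2, hr.1]⟩

theorem hasDerivAt_invLink {g : ℝ → ℝ}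
    (hg : ∀ γ ∈ Ioo (0 : ℝ) 1, DifferentiableAt ℝ g γ ∧ 0 < deriv g γ)
    {γ : ℝ} (hγ : γ ∈ Ioo (0 : ℝ) 1) :
    HasDerivAt (invLink g) (deriv g γ)⁻¹ (g γ) := by
  have hinv := invLink_apply hg hγ
  have hcont : ContinuousAt (invLink g) (g γ) := by
    rw [Metric.continuousAt_iff']
    intro ε hε
    have hmem := image_link_mem_nhds hg hγ (l := max 0 (γ - ε)) (r := min 1 (γ + ε))
      ⟨le_max_left _ _, max_lt hγ.1 (by linarith)⟩ ⟨lt_min hγ.2 (by linarith), min_le_left _ _⟩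
    filter_upwards [hmem]
    rintro _ ⟨y, hy, rfl⟩
    have hy1 := max_lt_iff.1 hy.1
    have hy2 := lt_min_iff.1 hy.2
    rw [hinv, invLink_apply hg ⟨hy1.1, hy2.1⟩, Real.dist_eq, abs_lt]
    constructor <;> linarith [hy1.2, hy2.2]
  refine HasDerivAt.of_local_left_inverse (f := g) hcont ?_ (hg γ hγ).2.ne' ?_
  · rw [hinv]
    exact (hg γ hγ).1.hasDerivAt
  · filter_upwards [image_link_mem_nhds hg hγ (l := 0) (r := 1) ⟨le_rfl, hγ.1⟩ ⟨hγ.2, le_rfl⟩]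
    rintro _ ⟨y, hy, rfl⟩
    rw [invLink_apply hg hy]

/-- The partial derivatives of the linear predictor with respect to `(β₁, β₂, θ₁, θ₂)`. -/
def predGrad (x : Fin 2 → ℝ) (j : Fin 2) : Fin 2 ⊕ Fin 2 → ℝ :=
  Sum.elim (fun s => -x s) (Pi.single j 1)

theorem linPred_update (ψ : Fin 2 ⊕ Fin 2 → ℝ) (x : Fin 2 → ℝ) (j : Fin 2)
    (s : Fin 2 ⊕ Fin 2) (r : ℝ) :
    linPred (Function.update ψ s r) x j = linPred ψ x j + (r - ψ s) * predGrad x j s := by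
  rcases s with s | s <;> fin_cases s <;> fin_cases j <;>
    simp [linPred, predGrad, Function.update_apply] <;> ring

theorem hasDerivAt_linPred (ψ : Fin 2 ⊕ Fin 2 → ℝ) (x : Fin 2 → ℝ) (j : Fin 2)
    (s : Fin 2 ⊕ Fin 2) :
    HasDerivAt (fun r => linPred (Function.update ψ s r) x j) (predGrad x j s) (ψ s) := by
  simp only [linPred_update]
  simpa using (((hasDerivAt_id (ψ s)).sub_const (ψ s)).mul_const (predGrad x j s)).const_add
    (linPred ψ x j)

/-! ### Fisher information of a single observation. -/

namespace Model
variable {m : ℕ} (M : Model m)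

theorem exists_gd_eq
    (hlink : ∀ γ ∈ Ioo (0 : ℝ) 1, DifferentiableAt ℝ M.link γ ∧ 0 < deriv M.link γ)
    (hwp : M.WellPosed) (i : Fin m) (j : Fin 2) :
    0 < M.gd i j ∧ HasDerivAt (invLink M.link) (M.gd i j) (linPred M.param (M.x i) j) := by
  obtain ⟨γ, hγ, h⟩ := hwp i j
  have hd := hasDerivAt_invLink hlink hγ
  rw [h] at hd
  have : M.gd i j = (deriv M.link γ)⁻¹ := hd.deriv
  rw [this]
  exact ⟨inv_pos.2 (hlink γ hγ).2, hd⟩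

theorem gd_pos (hlink : ∀ γ ∈ Ioo (0 : ℝ) 1, DifferentiableAt ℝ M.link γ ∧ 0 < deriv M.link γ)
    (hwp : M.WellPosed) (i : Fin m) (j : Fin 2) : 0 < M.gd i j :=
  (M.exists_gd_eq hlink hwp i j).1

theorem hasDerivAt_catProb
    (hlink : ∀ γ ∈ Ioo (0 : ℝ) 1, DifferentiableAt ℝ M.link γ ∧ 0 < deriv M.link γ)
    (hwp : M.WellPosed) (i : Fin m) (j : Fin 3) (s : Fin 2 ⊕ Fin 2) :
    HasDerivAt (fun r => catProb M.link (Function.update M.param s r) (M.x i) j)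
      (![M.gd i 0 * predGrad (M.x i) 0 s,
        M.gd i 1 * predGrad (M.x i) 1 s - M.gd i 0 * predGrad (M.x i) 0 s,
        -(M.gd i 1 * predGrad (M.x i) 1 s)] j) (M.param s) := by
  have key : ∀ k : Fin 2, HasDerivAt
      (fun r => invLink M.link (linPred (Function.update M.param s r) (M.x i) k))
      (M.gd i k * predGrad (M.x i) k s) (M.param s) := fun k => by
    have h1 := (M.exists_gd_eq hlink hwp i k).2
    have h2 := hasDerivAt_linPred M.param (M.x i) k s
    refine HasDerivAt.comp (M.param s) (h₂ := invLink M.link) ?_ h2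
    simpa using h1
  fin_cases j
  · simpa [catProb, cumProb] using key 0
  · simpa [catProb, cumProb] using (key 1).fun_sub (key 0)
  · simpa [catProb, cumProb] using (key 1).const_sub 1

theorem pointInfo_apply
    (hlink : ∀ γ ∈ Ioo (0 : ℝ) 1, DifferentiableAt ℝ M.link γ ∧ 0 < deriv M.link γ)
    (hwp : M.WellPosed) (hπ : ∀ i j, 0 < M.π i j ∧ M.π i j < 1) (i : Fin m)
    (s t : Fin 2 ⊕ Fin 2) :
    pointInfo M.link M.param (M.x i) s t =
      M.u₁ i * (predGrad (M.x i) 0 s * predGrad (M.x i) 0 t)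
        + M.u₂ i * (predGrad (M.x i) 1 s * predGrad (M.x i) 1 t)
        - M.b₂ i * (predGrad (M.x i) 0 s * predGrad (M.x i) 1 t
          + predGrad (M.x i) 1 s * predGrad (M.x i) 0 t) := by
  have hscore : ∀ j s, score M.link M.param (M.x i) j s =
      (![M.gd i 0 * predGrad (M.x i) 0 s,
        M.gd i 1 * predGrad (M.x i) 1 s - M.gd i 0 * predGrad (M.x i) 0 s,
        -(M.gd i 1 * predGrad (M.x i) 1 s)] j) / M.π i j := fun j s => by
    have h := (M.hasDerivAt_catProb hlink hwp i j s).log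
      (by rw [Function.update_eq_self]; exact (hπ i j).1.ne')
    rw [score, h.deriv]
    simp [π]
  have h0 := (hπ i 0).1.ne'
  have h1 := (hπ i 1).1.ne'
  have h2 := (hπ i 2).1.ne'
  have hcat : ∀ j, catProb M.link M.param (M.x i) j = M.π i j := fun _ => rfl
  simp only [pointInfo, Matrix.of_apply, hscore, hcat, Fin.sum_univ_three, u₁, u₂, b₂,
    Matrix.cons_val_zero, Matrix.cons_val_one, Matrix.cons_val]
  field_simp
  ring

theorem sum_π (i : Fin m) : M.π i 0 + M.π i 1 + M.π i 2 = 1 := by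
  simp [π, catProb, cumProb]

/-- Grouping the terms by category turns `e` into a sum of squares, from which positivity is
visible. -/
theorem e_eq (hπ : ∀ i j, 0 < M.π i j ∧ M.π i j < 1) (i : Fin m) :
    M.e i = M.gd i 0 ^ 2 / M.π i 0 + (M.gd i 0 - M.gd i 1) ^ 2 / M.π i 1
      + M.gd i 1 ^ 2 / M.π i 2 := by
  have h0 := (hπ i 0).1.ne'
  have h1 := (hπ i 1).1.ne'
  have h2 := (hπ i 2).1.ne'
  simp only [e, u₁, u₂, b₂]
  field_simp
  ring

theorem e_pos (hlink : ∀ γ ∈ Ioo (0 : ℝ) 1, DifferentiableAt ℝ M.link γ ∧ 0 < deriv M.link γ)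
    (hwp : M.WellPosed) (hπ : ∀ i j, 0 < M.π i j ∧ M.π i j < 1) (i : Fin m) : 0 < M.e i := by
  have h0 := (hπ i 0).1
  have h1 := (hπ i 1).1
  have h2 := (hπ i 2).1
  have g0 := M.gd_pos hlink hwp i 0
  rw [M.e_eq hπ]
  positivity

theorem w_pos (hlink : ∀ γ ∈ Ioo (0 : ℝ) 1, DifferentiableAt ℝ M.link γ ∧ 0 < deriv M.link γ)
    (hwp : M.WellPosed) (hπ : ∀ i j, 0 < M.π i j ∧ M.π i j < 1) (i : Fin m) : 0 < M.w i := by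
  have h0 := (hπ i 0).1
  have h1 := (hπ i 1).1
  have h2 := (hπ i 2).1
  have g0 := M.gd_pos hlink hwp i 0
  have g1 := M.gd_pos hlink hwp i 1
  have he := M.e_pos hlink hwp hπ i
  rw [w]
  positivity

/-- The right side is the determinant of the information about the two linear predictors. Over a
common denominator its numerator contains π₁ + π₂ + π₃, which equals 1. -/
theorem e_mul_w (hlink : ∀ γ ∈ Ioo (0 : ℝ) 1, DifferentiableAt ℝ M.link γ ∧ 0 < deriv M.link γ)
    (hwp : M.WellPosed) (hπ : ∀ i j, 0 < M.π i j ∧ M.π i j < 1) (i : Fin m) :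
    M.e i * M.w i = M.u₁ i * M.u₂ i - M.b₂ i ^ 2 := by
  have h0 := (hπ i 0).1.ne'
  have h1 := (hπ i 1).1.ne'
  have h2 := (hπ i 2).1.ne'
  have he := (M.e_pos hlink hwp hπ i).ne'
  have hs : M.π i 0 = 1 - M.π i 1 - M.π i 2 := by linarith [M.sum_π i]
  have : M.e i * M.w i = M.gd i 0 ^ 2 * M.gd i 1 ^ 2 * (M.π i 0 * M.π i 1 * M.π i 2)⁻¹ := by
    rw [w]
    field_simp
  rw [this]
  simp only [u₁, u₂, b₂]
  field_simp
  rw [hs]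
  ring

end Model

open Matrix

/-! ### First-order conditions for maximal determinants. -/

section Determinant
variable {n : Type*} [Fintype n] [DecidableEq n]

/-- Apply λ ≤ exp(λ - 1) to each eigenvalue and multiply. -/
theorem det_le_one_of_trace_le {P : Matrix n n ℝ} (hP : P.PosSemidef)
    (h : P.trace ≤ Fintype.card n) : P.det ≤ 1 := by
  have hdet := hP.isHermitian.det_eq_prod_eigenvalues
  have htr := hP.isHermitian.trace_eq_sum_eigenvalues
  simp only [RCLike.ofReal_real_eq_id, id_eq] at hdet htr
  rw [hdet]
  calc ∏ i, hP.isHermitian.eigenvalues i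
      ≤ ∏ i, Real.exp (hP.isHermitian.eigenvalues i - 1) :=
        Finset.prod_le_prod (fun i _ => hP.eigenvalues_nonneg i) fun i _ => by
          linarith [Real.add_one_le_exp (hP.isHermitian.eigenvalues i - 1)]
    _ = Real.exp (P.trace - Fintype.card n) := by
        rw [← Real.exp_sum, Finset.sum_sub_distrib, htr]
        simp
    _ ≤ 1 := Real.exp_le_one_iff.2 (by linarith)

/-- Writing M = BᴴB, congruence by B⁻¹ reduces to M = 1. This replaces concavity of log det and
allows N to be singular. -/
theorem det_le_of_trace_inv_mul_le {M N : Matrix n n ℝ} (hM : M.PosDef) (hN : N.PosSemidef)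
    (h : (M⁻¹ * N).trace ≤ Fintype.card n) : N.det ≤ M.det := by
  obtain ⟨B, hB⟩ : ∃ B : Matrix n n ℝ, M = Bᴴ * B := by
    open scoped MatrixOrder in
    exact CStarAlgebra.nonneg_iff_eq_star_mul_self.1 hM.posSemidef.nonneg
  have hpos := hM.det_pos
  have hdet : M.det = B.det * B.det := by
    rw [hB, det_mul, det_conjTranspose]
    simp
  have hB0 : B.det ≠ 0 := by
    rintro h0
    simp [hdet, h0] at hpos
  have hBu : IsUnit B.det := hB0.isUnit
  have hP : (B⁻¹ᴴ * N * B⁻¹).PosSemidef := hN.conjTranspose_mul_mul_same _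
  have hinv : M⁻¹ = B⁻¹ * B⁻¹ᴴ := by
    rw [hB, Matrix.mul_inv_rev, conjTranspose_nonsing_inv]
  have htr : (B⁻¹ᴴ * N * B⁻¹).trace = (M⁻¹ * N).trace := by
    rw [trace_mul_comm, ← mul_assoc, hinv]
  have h1 := det_le_one_of_trace_le hP (htr.trans_le h)
  rw [det_mul, det_mul, det_conjTranspose, det_nonsing_inv, Ring.inverse_eq_inv', star_trivial] at h1
  have : (B.det)⁻¹ * N.det * (B.det)⁻¹ = N.det / M.det := by
    rw [hdet]
    field_simp
  rw [this, div_le_one hpos] at h1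
  exact h1

theorem exists_det_one_add_smul_eq (X : Matrix n n ℝ) :
    ∃ r : ℝ → ℝ, Continuous r ∧ ∀ t : ℝ, (1 + t • X).det = 1 + X.trace * t + r t * t ^ 2 :=
  ⟨_, Polynomial.continuous _, fun t => det_one_add_smul t X⟩

/-- The one-sided derivative at t = 0 is det M · (tr(M⁻¹A) - n), which cannot be positive. -/
theorem trace_inv_mul_le_of_det_le {M A : Matrix n n ℝ} (hM : 0 < M.det)
    (h : ∀ t ∈ Ioo (0 : ℝ) 1, (M + t • (A - M)).det ≤ M.det) :
    (M⁻¹ * A).trace ≤ Fintype.card n := by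
  obtain ⟨r, hr, hexp⟩ := exists_det_one_add_smul_eq (M⁻¹ * A - 1)
  have hu : IsUnit M.det := hM.ne'.isUnit
  have key : ∀ t ∈ Ioo (0 : ℝ) 1, (M⁻¹ * A - 1).trace + r t * t ≤ 0 := fun t ht => by
    have h1 : M + t • (A - M) = M * (1 + t • (M⁻¹ * A - 1)) := by
      rw [mul_add, mul_one, mul_smul_comm, mul_sub, mul_one, mul_nonsing_inv_cancel_left _ _ hu]
    have h2 := h t ht
    rw [h1, det_mul, hexp] at h2
    have h3 : M.det * (t * ((M⁻¹ * A - 1).trace + r t * t)) ≤ 0 := by linarith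
    by_contra! h4
    have := mul_pos hM (mul_pos ht.1 h4)
    linarith
  have hlim : Filter.Tendsto (fun t => (M⁻¹ * A - 1).trace + r t * t) (nhdsWithin 0 (Ioi 0))
      (nhds ((M⁻¹ * A - 1).trace + r 0 * 0)) :=
    ((continuous_const.add (hr.mul continuous_id)).tendsto 0).mono_left nhdsWithin_le_nhds
  have hle := le_of_tendsto hlim (by
    filter_upwards [Ioo_mem_nhdsGT (zero_lt_one' ℝ)] with t ht using key t ht)
  rw [trace_sub, trace_one] at hle
  linarith

/-- Jacobi's formula, in a form that lets the trace be read off an explicit expansion without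
inverting M. -/
theorem det_mul_trace_inv_mul_of_det_expansion {M A : Matrix n n ℝ} (hM : M.det ≠ 0) {L R : ℝ}
    (h : ∀ t : ℝ, (M + t • A).det = M.det + t * L + t ^ 2 * R) :
    M.det * (M⁻¹ * A).trace = L := by
  obtain ⟨r, hr, hexp⟩ := exists_det_one_add_smul_eq (M⁻¹ * A)
  have key : ∀ t : ℝ, t ≠ 0 → M.det * ((M⁻¹ * A).trace + r t * t) = L + t * R := fun t ht => by
    have h1 : M + t • A = M * (1 + t • (M⁻¹ * A)) := by
      rw [mul_add, mul_one, mul_smul_comm, mul_nonsing_inv_cancel_left _ _ hM.isUnit]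
    have h2 := h t
    rw [h1, det_mul, hexp] at h2
    have h3 : t * (M.det * ((M⁻¹ * A).trace + r t * t)) = t * (L + t * R) := by linarith
    exact mul_left_cancel₀ ht h3
  have hl : Filter.Tendsto (fun t => M.det * ((M⁻¹ * A).trace + r t * t)) (nhdsWithin 0 {0}ᶜ)
      (nhds (M.det * ((M⁻¹ * A).trace + r 0 * 0))) :=
    ((continuous_const.mul (continuous_const.add (hr.mul continuous_id))).tendsto 0).mono_left
      nhdsWithin_le_nhds
  have hr : Filter.Tendsto (fun t : ℝ => L + t * R) (nhdsWithin 0 {0}ᶜ) (nhds (L + 0 * R)) :=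
    ((continuous_const.add (continuous_id.mul continuous_const)).tendsto 0).mono_left
      nhdsWithin_le_nhds
  have := tendsto_nhds_unique (hl.congr' (by
    filter_upwards [self_mem_nhdsWithin] with t ht using key t ht)) hr
  simpa using this

end Determinant

/-! ### The equivalence theorem for D-optimality. -/

namespace Model
variable {m : ℕ} (M : Model m)

/-- Off-diagonal weight of the information matrix in the coordinates `(θ₁, -β, θ₂ - θ₁)`. -/
def f (i : Fin m) : ℝ := M.u₂ i - M.b₂ i

theorem fisherInfo_apply (q : Fin m → ℝ) (s t : Fin 2 ⊕ Fin 2) :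
    M.fisherInfo q s t = ∑ i, q i * pointInfo M.link M.param (M.x i) s t := by
  simp [fisherInfo, Matrix.sum_apply]

theorem dotProduct_pointInfo (i : Fin m) (v : Fin 2 ⊕ Fin 2 → ℝ) :
    v ⬝ᵥ (pointInfo M.link M.param (M.x i) *ᵥ v) =
      ∑ j, catProb M.link M.param (M.x i) j
        * (∑ s, v s * score M.link M.param (M.x i) j s) ^ 2 := by
  simp only [dotProduct, mulVec, pointInfo, of_apply, sq,
    Fintype.sum_sum_type, Fin.sum_univ_two, Fin.sum_univ_three]
  ring

theorem posSemidef_pointInfo (hπ : ∀ i j, 0 < M.π i j ∧ M.π i j < 1)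
    (i : Fin m) : (pointInfo M.link M.param (M.x i)).PosSemidef := by
  refine .of_dotProduct_mulVec_nonneg ?_ fun v => ?_
  · ext s t
    simp [pointInfo, mul_comm]
  · rw [star_trivial, dotProduct_pointInfo]
    exact Finset.sum_nonneg fun j _ => mul_nonneg (hπ i j).1.le (sq_nonneg _)

theorem posSemidef_fisherInfo (hπ : ∀ i j, 0 < M.π i j ∧ M.π i j < 1)
    {q : Fin m → ℝ} (hq : ∀ i, 0 ≤ q i) :
    (M.fisherInfo q).PosSemidef :=
  posSemidef_sum _ fun i _ => (M.posSemidef_pointInfo hπ i).smul (hq i)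

theorem trace_inv_mul_fisherInfo (N : Matrix (Fin 2 ⊕ Fin 2) (Fin 2 ⊕ Fin 2) ℝ)
    (q : Fin m → ℝ) : (N⁻¹ * M.fisherInfo q).trace =
      ∑ i, q i * (N⁻¹ * pointInfo M.link M.param (M.x i)).trace := by
  simp [fisherInfo, Finset.mul_sum, Matrix.trace_sum]

/-- The general equivalence theorem for a nonsingular design. -/
theorem isDOptimal_iff_trace_le (hπ : ∀ i j, 0 < M.π i j ∧ M.π i j < 1)
    {p : Fin m → ℝ} (hp : p ∈ stdSimplex ℝ (Fin m))
    (hdet : 0 < (M.fisherInfo p).det) :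
    M.IsDOptimal p ↔
      ∀ i, ((M.fisherInfo p)⁻¹ * pointInfo M.link M.param (M.x i)).trace ≤ 4 := by
  have hcard : (Fintype.card (Fin 2 ⊕ Fin 2) : ℝ) = 4 := by norm_num
  constructor
  · rintro ⟨-, h⟩ i
    rw [← hcard]
    refine trace_inv_mul_le_of_det_le hdet fun t ht => ?_
    have hq : M.fisherInfo p + t • (pointInfo M.link M.param (M.x i) - M.fisherInfo p) =
        M.fisherInfo ((1 - t) • p + t • Pi.single i 1) := by
      ext a b
      simp only [Matrix.add_apply, Matrix.smul_apply, Matrix.sub_apply, fisherInfo_apply, smul_eq_mul, Pi.add_apply,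
        Pi.smul_apply, add_mul, Finset.sum_add_distrib, mul_assoc, ← Finset.mul_sum]
      simp [Pi.single_apply]
      ring
    rw [hq]
    exact h _ (convex_stdSimplex ℝ _ hp (single_mem_stdSimplex ℝ i) (by linarith [ht.2]) ht.1.le
      (by ring))
  · refine fun h => ⟨hp, fun q hq => ?_⟩
    refine det_le_of_trace_inv_mul_le
      ((M.posSemidef_fisherInfo hπ hp.1).posDef_iff_det_ne_zero.2 hdet.ne')
      (M.posSemidef_fisherInfo hπ hq.1) ?_
    rw [trace_inv_mul_fisherInfo, hcard]
    calc _ ≤ ∑ i, q i * 4 :=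
          Finset.sum_le_sum fun i _ => mul_le_mul_of_nonneg_left (h i) (hq.1 i)
      _ = 4 := by rw [← Finset.sum_mul, hq.2, one_mul]

end Model

/-! ### The determinant as a polynomial in the design weights. -/

/-- The determinant of an information matrix in terms of the moments in the coordinates
`(θ₁, -β, θ₂ - θ₁)`. -/
theorem det_eq_of_moments {N : Matrix (Fin 2 ⊕ Fin 2) (Fin 2 ⊕ Fin 2) ℝ}
    {g₀₀ g₀₁ g₀₂ g₁₁ g₁₂ g₂₂ v₀ v₁ v₂ c : ℝ}
    (hN : N = fromBlocks !![g₁₁, g₁₂; g₁₂, g₂₂] !![v₁ - g₀₁, -v₁; v₂ - g₀₂, -v₂]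
      !![v₁ - g₀₁, v₂ - g₀₂; -v₁, -v₂] !![g₀₀ + c - 2 * v₀, v₀ - c; v₀ - c, c]) :
    N.det = c * (g₀₀ * g₁₁ * g₂₂ + 2 * g₀₁ * g₁₂ * g₀₂ - g₀₀ * g₁₂ ^ 2 - g₁₁ * g₀₂ ^ 2
        - g₂₂ * g₀₁ ^ 2)
      - (v₀ ^ 2 * (g₁₁ * g₂₂ - g₁₂ ^ 2) + v₁ ^ 2 * (g₀₀ * g₂₂ - g₀₂ ^ 2)
        + v₂ ^ 2 * (g₀₀ * g₁₁ - g₀₁ ^ 2) + 2 * v₀ * v₁ * (g₀₂ * g₁₂ - g₀₁ * g₂₂)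
        + 2 * v₀ * v₂ * (g₀₁ * g₁₂ - g₀₂ * g₁₁) + 2 * v₁ * v₂ * (g₀₁ * g₀₂ - g₀₀ * g₁₂)) := by
  rw [← det_submatrix_equiv_self finSumFinEquiv.symm N, hN, det_succ_row_zero]
  have e0 : finSumFinEquiv.symm (0 : Fin (2 + 2)) = Sum.inl 0 := rfl
  have e1 : finSumFinEquiv.symm (1 : Fin (2 + 2)) = Sum.inl 1 := rfl
  have e2 : finSumFinEquiv.symm (2 : Fin (2 + 2)) = Sum.inr 0 := rfl
  have e3 : finSumFinEquiv.symm (3 : Fin (2 + 2)) = Sum.inr 1 := rfl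
  simp [Fin.sum_univ_succ, det_fin_three, Fin.succAbove, submatrix_apply, e0, e1, e2, e3,
    show (Fin.succ 2 : Fin 4) = 3 from rfl, show (Fin.castSucc 2 : Fin 4) = 2 from rfl]
  ring

/-- The determinant of the `3 × 3` matrix with rows `(1, x)`, `(1, y)`, `(1, z)`. -/
def area (x y z : Fin 2 → ℝ) : ℝ :=
  (y 0 - x 0) * (z 1 - x 1) - (z 0 - x 0) * (y 1 - x 1)

/-- Cauchy-Binet for det ∑ E x̃x̃ᵀ with x̃ = (1, x). -/
theorem moments_det_four (x₁ x₂ x₃ x₄ : Fin 2 → ℝ) (E₁ E₂ E₃ E₄ : ℝ) :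
    (E₁ + E₂ + E₃ + E₄) *
          (E₁ * x₁ 0 * x₁ 0 + E₂ * x₂ 0 * x₂ 0 + E₃ * x₃ 0 * x₃ 0 + E₄ * x₄ 0 * x₄ 0) *
          (E₁ * x₁ 1 * x₁ 1 + E₂ * x₂ 1 * x₂ 1 + E₃ * x₃ 1 * x₃ 1 + E₄ * x₄ 1 * x₄ 1)
        + 2 * (E₁ * x₁ 0 + E₂ * x₂ 0 + E₃ * x₃ 0 + E₄ * x₄ 0) *
          (E₁ * x₁ 0 * x₁ 1 + E₂ * x₂ 0 * x₂ 1 + E₃ * x₃ 0 * x₃ 1 + E₄ * x₄ 0 * x₄ 1) *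
          (E₁ * x₁ 1 + E₂ * x₂ 1 + E₃ * x₃ 1 + E₄ * x₄ 1)
        - (E₁ + E₂ + E₃ + E₄) *
          (E₁ * x₁ 0 * x₁ 1 + E₂ * x₂ 0 * x₂ 1 + E₃ * x₃ 0 * x₃ 1 + E₄ * x₄ 0 * x₄ 1) ^ 2
        - (E₁ * x₁ 0 * x₁ 0 + E₂ * x₂ 0 * x₂ 0 + E₃ * x₃ 0 * x₃ 0 + E₄ * x₄ 0 * x₄ 0) *
          (E₁ * x₁ 1 + E₂ * x₂ 1 + E₃ * x₃ 1 + E₄ * x₄ 1) ^ 2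
        - (E₁ * x₁ 1 * x₁ 1 + E₂ * x₂ 1 * x₂ 1 + E₃ * x₃ 1 * x₃ 1 + E₄ * x₄ 1 * x₄ 1) *
          (E₁ * x₁ 0 + E₂ * x₂ 0 + E₃ * x₃ 0 + E₄ * x₄ 0) ^ 2 =
      E₁ * E₂ * E₃ * area x₁ x₂ x₃ ^ 2 + E₁ * E₂ * E₄ * area x₁ x₂ x₄ ^ 2
        + E₁ * E₃ * E₄ * area x₁ x₃ x₄ ^ 2 + E₂ * E₃ * E₄ * area x₂ x₃ x₄ ^ 2 := by
  simp only [area]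
  ring

/-- For G = ∑ E x̃x̃ᵀ, adj G is the sum over pairs of EⱼEₖ nnᵀ with n = x̃ⱼ × x̃ₖ (`hsq`). Since v =
∑ y x̃, each product n·v is a combination of areas (`hcross`). -/
theorem moments_adjugate_four (x₁ x₂ x₃ x₄ : Fin 2 → ℝ) (E₁ E₂ E₃ E₄ y₁ y₂ y₃ y₄ : ℝ)
    {g₀₀ g₀₁ g₀₂ g₁₁ g₁₂ g₂₂ v₀ v₁ v₂ : ℝ}
    (h₀₀ : g₀₀ = E₁ + E₂ + E₃ + E₄)
    (h₀₁ : g₀₁ = E₁ * x₁ 0 + E₂ * x₂ 0 + E₃ * x₃ 0 + E₄ * x₄ 0)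
    (h₀₂ : g₀₂ = E₁ * x₁ 1 + E₂ * x₂ 1 + E₃ * x₃ 1 + E₄ * x₄ 1)
    (h₁₁ : g₁₁ = E₁ * x₁ 0 * x₁ 0 + E₂ * x₂ 0 * x₂ 0 + E₃ * x₃ 0 * x₃ 0 + E₄ * x₄ 0 * x₄ 0)
    (h₁₂ : g₁₂ = E₁ * x₁ 0 * x₁ 1 + E₂ * x₂ 0 * x₂ 1 + E₃ * x₃ 0 * x₃ 1 + E₄ * x₄ 0 * x₄ 1)
    (h₂₂ : g₂₂ = E₁ * x₁ 1 * x₁ 1 + E₂ * x₂ 1 * x₂ 1 + E₃ * x₃ 1 * x₃ 1 + E₄ * x₄ 1 * x₄ 1)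
    (h₀ : v₀ = y₁ + y₂ + y₃ + y₄)
    (h₁ : v₁ = y₁ * x₁ 0 + y₂ * x₂ 0 + y₃ * x₃ 0 + y₄ * x₄ 0)
    (h₂ : v₂ = y₁ * x₁ 1 + y₂ * x₂ 1 + y₃ * x₃ 1 + y₄ * x₄ 1) :
    v₀ ^ 2 * (g₁₁ * g₂₂ - g₁₂ ^ 2) + v₁ ^ 2 * (g₀₀ * g₂₂ - g₀₂ ^ 2)
        + v₂ ^ 2 * (g₀₀ * g₁₁ - g₀₁ ^ 2) + 2 * v₀ * v₁ * (g₀₂ * g₁₂ - g₀₁ * g₂₂)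
        + 2 * v₀ * v₂ * (g₀₁ * g₁₂ - g₀₂ * g₁₁) + 2 * v₁ * v₂ * (g₀₁ * g₀₂ - g₀₀ * g₁₂) =
      E₁ * E₂ * (y₃ * area x₁ x₂ x₃ + y₄ * area x₁ x₂ x₄) ^ 2
        + E₁ * E₃ * (y₂ * area x₁ x₂ x₃ - y₄ * area x₁ x₃ x₄) ^ 2
        + E₂ * E₃ * (y₁ * area x₁ x₂ x₃ + y₄ * area x₂ x₃ x₄) ^ 2
        + E₁ * E₄ * (y₂ * area x₁ x₂ x₄ + y₃ * area x₁ x₃ x₄) ^ 2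
        + E₂ * E₄ * (y₁ * area x₁ x₂ x₄ - y₃ * area x₂ x₃ x₄) ^ 2
        + E₃ * E₄ * (y₁ * area x₁ x₃ x₄ + y₂ * area x₂ x₃ x₄) ^ 2 := by
  have hcross : ∀ x x' : Fin 2 → ℝ, v₀ * (x 0 * x' 1 - x 1 * x' 0) + v₁ * (x 1 - x' 1)
      + v₂ * (x' 0 - x 0) = y₁ * area x x' x₁ + y₂ * area x x' x₂ + y₃ * area x x' x₃
        + y₄ * area x x' x₄ := fun x x' => by
    subst h₀ h₁ h₂
    simp only [area]
    ring
  have hsq : v₀ ^ 2 * (g₁₁ * g₂₂ - g₁₂ ^ 2) + v₁ ^ 2 * (g₀₀ * g₂₂ - g₀₂ ^ 2)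
        + v₂ ^ 2 * (g₀₀ * g₁₁ - g₀₁ ^ 2) + 2 * v₀ * v₁ * (g₀₂ * g₁₂ - g₀₁ * g₂₂)
        + 2 * v₀ * v₂ * (g₀₁ * g₁₂ - g₀₂ * g₁₁) + 2 * v₁ * v₂ * (g₀₁ * g₀₂ - g₀₀ * g₁₂) =
      E₁ * E₂ * (v₀ * (x₁ 0 * x₂ 1 - x₁ 1 * x₂ 0) + v₁ * (x₁ 1 - x₂ 1)
          + v₂ * (x₂ 0 - x₁ 0)) ^ 2
        + E₁ * E₃ * (v₀ * (x₁ 0 * x₃ 1 - x₁ 1 * x₃ 0) + v₁ * (x₁ 1 - x₃ 1)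
          + v₂ * (x₃ 0 - x₁ 0)) ^ 2
        + E₂ * E₃ * (v₀ * (x₂ 0 * x₃ 1 - x₂ 1 * x₃ 0) + v₁ * (x₂ 1 - x₃ 1)
          + v₂ * (x₃ 0 - x₂ 0)) ^ 2
        + E₁ * E₄ * (v₀ * (x₁ 0 * x₄ 1 - x₁ 1 * x₄ 0) + v₁ * (x₁ 1 - x₄ 1)
          + v₂ * (x₄ 0 - x₁ 0)) ^ 2
        + E₂ * E₄ * (v₀ * (x₂ 0 * x₄ 1 - x₂ 1 * x₄ 0) + v₁ * (x₂ 1 - x₄ 1)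
          + v₂ * (x₄ 0 - x₂ 0)) ^ 2
        + E₃ * E₄ * (v₀ * (x₃ 0 * x₄ 1 - x₃ 1 * x₄ 0) + v₁ * (x₃ 1 - x₄ 1)
          + v₂ * (x₄ 0 - x₃ 0)) ^ 2 := by
    subst h₀₀ h₀₁ h₀₂ h₁₁ h₁₂ h₂₂
    ring
  rw [hsq]
  simp only [hcross]
  have r1 : ∀ x y, area x y x = 0 := fun x y => by simp only [area]; ring
  have r2 : ∀ x y, area x y y = 0 := fun x y => by simp only [area]; ring
  have r3 : ∀ x y z, area x y z = - area x z y := fun x y z => by simp only [area]; ring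
  have r4 : ∀ x y z, area x y z = area y z x := fun x y z => by simp only [area]; ring
  simp only [r1, r2]
  rw [r3 x₁ x₃ x₂, ← r4 x₁ x₂ x₃, r3 x₁ x₄ x₂, r3 x₁ x₄ x₃, ← r4 x₁ x₂ x₄, r3 x₂ x₄ x₃,
    ← r4 x₁ x₃ x₄, ← r4 x₂ x₃ x₄]
  ring

namespace Model
variable {m : ℕ} (M : Model m)

theorem minor_eq_area (i j k : Fin m) : M.minor i j k = area (M.x i) (M.x j) (M.x k) := by
  rw [minor, det_fin_three]
  simp [X₁, area]
  ring

/-- The linear relation among the four minors; it eliminates `minor b c i`, so that the determinant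
identities become polynomial identities in independent quantities. -/
theorem minor_expansion (a b c i : Fin m) :
    M.minor b c i = M.minor a b c + M.minor a c i - M.minor a b i := by
  simp only [minor_eq_area, area]
  ring

/-- The coefficient of `p i` in the determinant of the information matrix of a design
on the points `a, b, c, i`. -/
def detCoeff (p : Fin m → ℝ) (a b c i : Fin m) : ℝ :=
  M.minor a b i ^ 2 * M.e a * M.e b * M.e i * p a * p b * (M.w a * p a + M.w b * p b)
    + M.minor a c i ^ 2 * M.e a * M.e c * M.e i * p a * p c * (M.w a * p a + M.w c * p c)
    + M.minor b c i ^ 2 * M.e b * M.e c * M.e i * p b * p c * (M.w b * p b + M.w c * p c)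
    + M.D a b c i * p a * p b * p c

/-- The determinant of the information matrix of a design on the points `a, b, c`. -/
def detThree (p : Fin m → ℝ) (a b c : Fin m) : ℝ :=
  M.minor a b c ^ 2 * M.e a * M.e b * M.e c * p a * p b * p c
    * (M.w a * p a + M.w b * p b + M.w c * p c)

theorem u₁_eq (i : Fin m) : M.u₁ i = M.e i + M.u₂ i - 2 * M.f i := by
  simp only [e, f]
  ring

theorem b₂_eq (i : Fin m) : M.b₂ i = M.u₂ i - M.f i := by
  simp only [f]
  ring

theorem e_mul_w_eq (hlink : ∀ γ ∈ Ioo (0 : ℝ) 1, DifferentiableAt ℝ M.link γ ∧ 0 < deriv M.link γ)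
    (hwp : M.WellPosed) (hπ : ∀ i j, 0 < M.π i j ∧ M.π i j < 1) (i : Fin m) :
    M.e i * M.w i = M.e i * M.u₂ i - M.f i ^ 2 := by
  rw [M.e_mul_w hlink hwp hπ, u₁_eq, b₂_eq]
  ring

theorem D_eq (a b c i : Fin m) :
    M.D a b c i =
      M.e a * M.e b * (M.e c * M.u₂ i + M.e i * M.u₂ c - 2 * M.f c * M.f i)
          * M.minor a b c * M.minor a b i
        - M.e a * M.e c * (M.e b * M.u₂ i + M.e i * M.u₂ b - 2 * M.f b * M.f i)
          * M.minor a b c * M.minor a c i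
        + M.e a * M.e i * (M.e b * M.u₂ c + M.e c * M.u₂ b - 2 * M.f b * M.f c)
          * M.minor a b i * M.minor a c i
        + M.e b * M.e c * (M.e a * M.u₂ i + M.e i * M.u₂ a - 2 * M.f a * M.f i)
          * M.minor a b c * M.minor b c i
        - M.e b * M.e i * (M.e a * M.u₂ c + M.e c * M.u₂ a - 2 * M.f a * M.f c)
          * M.minor a b i * M.minor b c i
        + M.e c * M.e i * (M.e a * M.u₂ b + M.e b * M.u₂ a - 2 * M.f a * M.f b)
          * M.minor a c i * M.minor b c i := by
  have r3 : ∀ i j k, M.minor i j k = -M.minor i k j := fun i j k => by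
    simp only [minor_eq_area, area]
    ring
  have r4 : ∀ i j k, M.minor i j k = M.minor j k i := fun i j k => by
    simp only [minor_eq_area, area]
    ring
  simp only [D, Dterm, u₁_eq, b₂_eq]
  rw [r3 a c b, r3 a i b, r3 a i c, ← r4 a b c, ← r4 a b i, r3 b i c, ← r4 b c i,
    r4 c i a, r4 i a c]
  ring

theorem sum_mul_eq {p : Fin m → ℝ} {a b c : Fin m} (hab : a ≠ b) (hac : a ≠ c) (hbc : b ≠ c)
    (hsupp : ∀ i, i ≠ a → i ≠ b → i ≠ c → p i = 0) (F : Fin m → ℝ) :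
    ∑ i, p i * F i = p a * F a + p b * F b + p c * F c := by
  rw [← Finset.sum_subset (Finset.subset_univ {a, b, c})]
  · rw [Finset.sum_insert (by simp [hab, hac]), Finset.sum_insert (by simp [hbc]),
      Finset.sum_singleton]
    ring
  · intro i _ hi
    simp only [Finset.mem_insert, Finset.mem_singleton, not_or] at hi
    rw [hsupp i hi.1 hi.2.1 hi.2.2, zero_mul]

theorem exists_det_fisherInfo_add_smul
    (hlink : ∀ γ ∈ Ioo (0 : ℝ) 1, DifferentiableAt ℝ M.link γ ∧ 0 < deriv M.link γ)
    (hwp : M.WellPosed) (hπ : ∀ i j, 0 < M.π i j ∧ M.π i j < 1)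
    {p : Fin m → ℝ} {a b c : Fin m} (hab : a ≠ b) (hac : a ≠ c) (hbc : b ≠ c)
    (hsupp : ∀ i, i ≠ a → i ≠ b → i ≠ c → p i = 0) (i : Fin m) :
    ∃ R : ℝ, ∀ t : ℝ, (M.fisherInfo p + t • pointInfo M.link M.param (M.x i)).det =
      M.detThree p a b c + t * M.detCoeff p a b c i + t ^ 2 * R := by
  -- One observation contributes a matrix of rank at most two, so there is no t³ term; the witness
  -- is the t² coefficient.
  refine ⟨(M.u₂ i * M.e i - M.f i ^ 2) *
    (p a * p b * M.e a * M.e b * M.minor a b i ^ 2 + p a * p c * M.e a * M.e c * M.minor a c i ^ 2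
      + p b * p c * M.e b * M.e c * M.minor b c i ^ 2), fun t => ?_⟩
  rw [det_eq_of_moments
    (g₀₀ := p a * M.e a + p b * M.e b + p c * M.e c + t * M.e i)
    (g₀₁ := p a * M.e a * M.x a 0 + p b * M.e b * M.x b 0 + p c * M.e c * M.x c 0
      + t * M.e i * M.x i 0)
    (g₀₂ := p a * M.e a * M.x a 1 + p b * M.e b * M.x b 1 + p c * M.e c * M.x c 1
      + t * M.e i * M.x i 1)
    (g₁₁ := p a * M.e a * M.x a 0 * M.x a 0 + p b * M.e b * M.x b 0 * M.x b 0
      + p c * M.e c * M.x c 0 * M.x c 0 + t * M.e i * M.x i 0 * M.x i 0)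
    (g₁₂ := p a * M.e a * M.x a 0 * M.x a 1 + p b * M.e b * M.x b 0 * M.x b 1
      + p c * M.e c * M.x c 0 * M.x c 1 + t * M.e i * M.x i 0 * M.x i 1)
    (g₂₂ := p a * M.e a * M.x a 1 * M.x a 1 + p b * M.e b * M.x b 1 * M.x b 1
      + p c * M.e c * M.x c 1 * M.x c 1 + t * M.e i * M.x i 1 * M.x i 1)
    (v₀ := p a * M.f a + p b * M.f b + p c * M.f c + t * M.f i)
    (v₁ := p a * M.f a * M.x a 0 + p b * M.f b * M.x b 0 + p c * M.f c * M.x c 0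
      + t * M.f i * M.x i 0)
    (v₂ := p a * M.f a * M.x a 1 + p b * M.f b * M.x b 1 + p c * M.f c * M.x c 1
      + t * M.f i * M.x i 1)
    (c := p a * M.u₂ a + p b * M.u₂ b + p c * M.u₂ c + t * M.u₂ i) ?_,
    moments_det_four, moments_adjugate_four _ _ _ _ _ _ _ _ _ _ _ _ rfl rfl rfl rfl rfl rfl rfl
    rfl rfl]
  · have hw := M.e_mul_w_eq hlink hwp hπ
    simp only [← minor_eq_area]
    rw [detCoeff, detThree, D_eq, M.minor_expansion a b c i]
    linear_combination
      -(M.minor a b c ^ 2 * M.e b * M.e c * p a ^ 2 * p b * p c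
        + t * M.e i * p a ^ 2 * (M.minor a b i ^ 2 * M.e b * p b
          + M.minor a c i ^ 2 * M.e c * p c)) * hw a
      - (M.minor a b c ^ 2 * M.e a * M.e c * p a * p b ^ 2 * p c
        + t * M.e i * p b ^ 2 * (M.minor a b i ^ 2 * M.e a * p a
          + (M.minor a b c + M.minor a c i - M.minor a b i) ^ 2 * M.e c * p c)) * hw b
      - (M.minor a b c ^ 2 * M.e a * M.e b * p a * p b * p c ^ 2
        + t * M.e i * p c ^ 2 * (M.minor a c i ^ 2 * M.e a * p a
          + (M.minor a b c + M.minor a c i - M.minor a b i) ^ 2 * M.e b * p b)) * hw c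
  · ext s u
    rw [Matrix.add_apply, Matrix.smul_apply, fisherInfo_apply, sum_mul_eq hab hac hbc hsupp]
    simp only [M.pointInfo_apply hlink hwp hπ, u₁_eq, b₂_eq]
    rcases s with s | s <;> rcases u with u | u <;> fin_cases s <;> fin_cases u <;>
      simp [predGrad] <;> ring

end Model

/-! ### Cardano's formula with three real roots. -/

/-- Cardano's formula with principal values in the case of three distinct real roots. -/
theorem cardano_formula_of_discr {b₀ b₁ b₂ R : ℝ}
    (hR : R = 27 * b₀ ^ 2 + 4 * b₁ ^ 3 - 18 * b₀ * b₁ * b₂ - b₁ ^ 2 * b₂ ^ 2 + 4 * b₀ * b₂ ^ 3)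
    (hneg : R < 0) {A : ℂ}
    (hA : A = ((-27 * b₀ + 9 * b₁ * b₂ - 2 * b₂ ^ 3 : ℝ) : ℂ)
      + (3 : ℂ) ^ (3 / 2 : ℂ) * (R : ℂ) ^ (1 / 2 : ℂ)) :
    ∃ y : ℝ, -(b₂ : ℂ) / 3 - (2 : ℂ) ^ (1 / 3 : ℂ) * ((3 * b₁ - b₂ ^ 2 : ℝ) : ℂ)
        / (3 * A ^ (1 / 3 : ℂ)) + A ^ (1 / 3 : ℂ) / (3 * (2 : ℂ) ^ (1 / 3 : ℂ)) = y ∧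
      y ^ 3 + b₂ * y ^ 2 + b₁ * y + b₀ = 0 ∧ 0 < 3 * y + b₂ ∧
      b₂ ^ 2 - 3 * b₁ < (3 * y + b₂) ^ 2 := by
  set N : ℝ := -27 * b₀ + 9 * b₁ * b₂ - 2 * b₂ ^ 3 with hN
  -- `R` is minus the discriminant. As it is negative, its principal square root is a positive
  -- multiple of i, and A = N + ih lies in the open upper half-plane.
  set h : ℝ := (3 : ℝ) ^ (3 / 2 : ℝ) * (-R) ^ (1 / 2 : ℝ) with hh
  set κ : ℝ := (2 : ℝ) ^ (1 / 3 : ℝ) with hκ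
  have hhpos : 0 < h := mul_pos (by positivity) (Real.rpow_pos_of_pos (by linarith) _)
  have hκpos : 0 < κ := by positivity
  have hκ3 : κ ^ 3 = 2 := by
    rw [hκ, ← Real.rpow_natCast, ← Real.rpow_mul (by norm_num)]
    norm_num
  have hh2 : h ^ 2 = -27 * R := by
    rw [hh, mul_pow, ← Real.rpow_natCast, ← Real.rpow_natCast, ← Real.rpow_mul (by norm_num),
      ← Real.rpow_mul (by linarith)]
    norm_num
  have h3 : (3 : ℂ) ^ (3 / 2 : ℂ) = (((3 : ℝ) ^ (3 / 2 : ℝ) : ℝ) : ℂ) := by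
    rw [Complex.ofReal_cpow (by norm_num)]
    norm_num
  have h2 : (2 : ℂ) ^ (1 / 3 : ℂ) = (κ : ℂ) := by
    rw [hκ, Complex.ofReal_cpow (by norm_num)]
    norm_num
  have hRt : (R : ℂ) ^ (1 / 2 : ℂ) = (((-R) ^ (1 / 2 : ℝ) : ℝ) : ℂ) * Complex.I := by
    rw [Complex.ofReal_cpow_of_nonpos hneg.le, Complex.ofReal_cpow (by linarith)]
    congr 1
    · norm_num
    · rw [show (Real.pi : ℂ) * Complex.I * (1 / 2) = (Real.pi : ℂ) / 2 * Complex.I by ring,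
        Complex.exp_pi_div_two_mul_I]
  have hAre : A = (N : ℂ) + (h : ℂ) * Complex.I := by
    rw [hA, h3, hRt, hh]
    push_cast
    ring
  have hA_re : A.re = N := by simp [hAre]
  have hA_im : A.im = h := by simp [hAre]
  have hA0 : A ≠ 0 := fun h0 => by
    rw [h0] at hA_im
    simp at hA_im
    linarith
  set D : ℝ := b₂ ^ 2 - 3 * b₁ with hD
  have hnorm : N ^ 2 + h ^ 2 = 4 * D ^ 3 := by
    rw [hh2, hN, hD, hR]
    ring
  set z : ℂ := A ^ (1 / 3 : ℂ) with hz
  have hz3 : z ^ 3 = A := by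
    rw [hz, show (1 / 3 : ℂ) = ((3 : ℕ) : ℂ)⁻¹ by norm_num]
    exact Complex.cpow_nat_inv_pow A (by norm_num)
  have hz0 : z ≠ 0 := fun h0 => hA0 (by rw [← hz3, h0]; norm_num)
  have hre3 : z.re ^ 3 - 3 * z.re * z.im ^ 2 = N := by
    rw [← hA_re, ← hz3]
    simp [pow_succ]
    ring
  have him3 : 3 * z.re ^ 2 * z.im - z.im ^ 3 = h := by
    rw [← hA_im, ← hz3]
    simp [pow_succ]
    ring
  -- |A|² = 4D³ and κ⁶ = 4 make the cubes agree. Hence κ²D / z is the conjugate of z, so the two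
  -- Cardano terms are conjugate and their sum is real.
  have hsq : z.re ^ 2 + z.im ^ 2 = κ ^ 2 * D := by
    have : (z.re ^ 2 + z.im ^ 2) ^ 3 = (κ ^ 2 * D) ^ 3 := by
      rw [mul_pow, ← pow_mul, show κ ^ (2 * 3) = (κ ^ 3) ^ 2 by ring, hκ3]
      linear_combination hnorm + (z.re ^ 3 - 3 * z.re * z.im ^ 2 + N) * hre3
        + (3 * z.re ^ 2 * z.im - z.im ^ 3 + h) * him3
    exact (Odd.strictMono_pow (by decide : Odd 3)).injective this
  have harg0 : 0 < A.arg := by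
    refine lt_of_le_of_ne (Complex.arg_nonneg_iff.2 (by rw [hA_im]; exact hhpos.le)) fun h0 => ?_
    have := (Complex.arg_eq_zero_iff.1 h0.symm).2
    rw [hA_im] at this
    linarith
  have hargπ : A.arg ≤ Real.pi := Complex.arg_le_pi A
  have hzexp : z = Complex.exp (Complex.log A * (1 / 3)) := Complex.cpow_def_of_ne_zero hA0 _
  have hz_re : z.re = Real.exp (Real.log ‖A‖ / 3) * Real.cos (A.arg / 3) := by
    rw [hzexp, Complex.exp_re]
    congr 2 <;> simp [Complex.log] <;> ring
  have hz_im : z.im = Real.exp (Real.log ‖A‖ / 3) * Real.sin (A.arg / 3) := by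
    rw [hzexp, Complex.exp_im]
    congr 2 <;> simp [Complex.log] <;> ring
  have hz_im_pos : 0 < z.im := by
    rw [hz_im]
    exact mul_pos (Real.exp_pos _)
      (Real.sin_pos_of_pos_of_lt_pi (by linarith) (by linarith [Real.pi_pos]))
  have hz_re_pos : 0 < z.re := by
    rw [hz_re]
    exact mul_pos (Real.exp_pos _)
      (Real.cos_pos_of_mem_Ioo ⟨by linarith [Real.pi_pos], by linarith [Real.pi_pos]⟩)
  -- The principal cube root has argument below π/3. This puts y beyond both critical points of the
  -- cubic, where (3y + b₂)² = D, and so makes it the largest root.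
  have hgt : z.im ^ 2 < 3 * z.re ^ 2 := by
    have : 0 < z.im * (3 * z.re ^ 2 - z.im ^ 2) := by linarith
    linarith [(pos_iff_pos_of_mul_pos this).1 hz_im_pos]
  have hzc : z * (starRingEnd ℂ) z = ((κ ^ 2 * D : ℝ) : ℂ) := by
    rw [Complex.mul_conj, Complex.normSq_apply, ← hsq]
    congr 1
    ring
  have hκc : (κ : ℂ) ≠ 0 := by exact_mod_cast hκpos.ne'
  set ρ : ℝ := z.re / κ with hρ
  have hzρ : z.re = κ * ρ := by
    rw [hρ]
    field_simp
  refine ⟨(2 * ρ - b₂) / 3, ?_, ?_, ?_, ?_⟩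
  · rw [h2]
    have hconj : (starRingEnd ℂ) z = 2 * (z.re : ℂ) - z := by
      have := Complex.add_conj z
      push_cast at this
      linear_combination this
    rw [hconj, hzρ] at hzc
    rw [show (3 * b₁ - b₂ ^ 2 : ℝ) = -D by rw [hD]; ring]
    push_cast at hzc ⊢
    field_simp
    linear_combination (-1 : ℂ) * hzc
  · rw [hzρ] at hre3 hsq
    have e1 : 8 * ρ ^ 3 - 6 * D * ρ = N := by
      linear_combination hre3 + 3 * κ * ρ * hsq + (-4 * ρ ^ 3 + 3 * ρ * D) * hκ3
    rw [hN, hD] at e1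
    linear_combination e1 / 27
  · have : 0 < ρ := div_pos hz_re_pos hκpos
    linarith
  · rw [hzρ] at hgt hsq
    have : κ ^ 2 * D < κ ^ 2 * (2 * ρ) ^ 2 := by linarith
    have := lt_of_mul_lt_mul_left this (by positivity)
    rw [show 3 * ((2 * ρ - b₂) / 3) + b₂ = 2 * ρ by ring]
    exact this

/-! ### Stationary allocations on three points. -/

/-- The stationarity conditions for `p₁ p₂ p₃ (w₁ p₁ + w₂ p₂ + w₃ p₃)` on the simplex. -/
def IsStationary (w₁ w₂ w₃ p₁ p₂ p₃ : ℝ) : Prop :=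
  (0 < p₁ ∧ 0 < p₂ ∧ 0 < p₃) ∧ p₁ + p₂ + p₃ = 1 ∧
    (w₁ * p₁ + w₂ * p₂ + w₃ * p₃) * (p₃ - p₁) + (w₁ - w₃) * p₁ * p₃ = 0 ∧
    (w₁ * p₁ + w₂ * p₂ + w₃ * p₃) * (p₃ - p₂) + (w₂ - w₃) * p₂ * p₃ = 0

/-- The Lagrange equations with their multiplier: it must be 4, as summing the three equations
shows. This form is symmetric in the points and is the one produced by the equivalence theorem. -/
theorem isStationary_iff {w₁ w₂ w₃ p₁ p₂ p₃ : ℝ} :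
    IsStationary w₁ w₂ w₃ p₁ p₂ p₃ ↔ (0 < p₁ ∧ 0 < p₂ ∧ 0 < p₃) ∧ p₁ + p₂ + p₃ = 1 ∧
      w₁ * p₁ + w₂ * p₂ + w₃ * p₃ + w₁ * p₁ = 4 * p₁ * (w₁ * p₁ + w₂ * p₂ + w₃ * p₃) ∧
      w₁ * p₁ + w₂ * p₂ + w₃ * p₃ + w₂ * p₂ = 4 * p₂ * (w₁ * p₁ + w₂ * p₂ + w₃ * p₃) ∧
      w₁ * p₁ + w₂ * p₂ + w₃ * p₃ + w₃ * p₃ = 4 * p₃ * (w₁ * p₁ + w₂ * p₂ + w₃ * p₃) := by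
  constructor
  · rintro ⟨hp, hsum, h1, h2⟩
    have h3 : w₁ * p₁ + w₂ * p₂ + w₃ * p₃ + w₃ * p₃ =
        4 * p₃ * (w₁ * p₁ + w₂ * p₂ + w₃ * p₃) := by
      linear_combination (-(w₁ * p₁ + w₂ * p₂ + 2 * w₃ * p₃)) * hsum - h1 - h2
    refine ⟨hp, hsum, ?_, ?_, h3⟩
    · refine mul_left_cancel₀ hp.2.2.ne' ?_
      linear_combination h1 + p₁ * h3
    · refine mul_left_cancel₀ hp.2.2.ne' ?_
      linear_combination h2 + p₂ * h3
  · rintro ⟨hp, hsum, h1, h2, h3⟩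
    exact ⟨hp, hsum, by linear_combination p₃ * h1 - p₁ * h3,
      by linear_combination p₃ * h2 - p₂ * h3⟩

/-- Stationarity does not depend on the numbering of the three points. -/
theorem isStationary_perm {w p : Fin 3 → ℝ} (σ : Equiv.Perm (Fin 3)) :
    IsStationary (w (σ 0)) (w (σ 1)) (w (σ 2)) (p (σ 0)) (p (σ 1)) (p (σ 2)) ↔
      IsStationary (w 0) (w 1) (w 2) (p 0) (p 1) (p 2) := by
  have key : ∀ w p : Fin 3 → ℝ, IsStationary (w 0) (w 1) (w 2) (p 0) (p 1) (p 2) ↔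
      (∀ k, 0 < p k) ∧ ∑ k, p k = 1 ∧
        ∀ k, (∑ j, w j * p j) + w k * p k = 4 * p k * ∑ j, w j * p j := fun w p => by
    simp [isStationary_iff, Fin.forall_fin_succ, Fin.sum_univ_three]
  have h := key (w ∘ σ) (p ∘ σ)
  simp only [Function.comp_apply] at h
  rw [h, key w p, Equiv.sum_comp σ p, Equiv.sum_comp σ fun j => w j * p j]
  exact and_congr (σ.surjective.forall (p := fun k => 0 < p k)).symm (and_congr Iff.rfl
    (σ.surjective.forall (p := fun k =>
      (∑ j, w j * p j) + w k * p k = 4 * p k * ∑ j, w j * p j)).symm)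

/-- The roots of x² - 2Bx - c have product -c < 0, so only one is positive. -/
theorem eq_add_sqrt_of_sq_eq {x B c : ℝ} (hx : 0 < x) (hc : 0 < c) (h : x ^ 2 = 2 * B * x + c) :
    x = B + √(B ^ 2 + c) := by
  have h1 : (x - B) ^ 2 = B ^ 2 + c := by linear_combination h
  have h2 : 0 ≤ x - B := by
    by_contra! h2
    have : x * (x - 2 * B) = c := by linear_combination h
    have h4 := (pos_iff_pos_of_mul_pos (by rw [this]; exact hc)).1 hx
    linarith
  rw [← h1, Real.sqrt_sq h2]
  ring

theorem add_sqrt_pos {B c : ℝ} (hc : 0 < c) : 0 < B + √(B ^ 2 + c) := by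
  have : |B| < √(B ^ 2 + c) := Real.lt_sqrt_of_sq_lt (by rw [sq_abs]; linarith)
  linarith [neg_abs_le B]

theorem sq_add_sqrt {B c : ℝ} (hc : 0 < c) :
    (B + √(B ^ 2 + c)) ^ 2 = 2 * B * (B + √(B ^ 2 + c)) + c := by
  have := Real.sq_sqrt (show 0 ≤ B ^ 2 + c by positivity)
  linear_combination this

theorem isStationary_iff_of_eq_right {w v p₁ p₂ p₃ Δ : ℝ} (hw : 0 < w) (hv : 0 < v)
    (hΔ : Δ = 2 * w - 3 * v + √(4 * w ^ 2 - 4 * w * v + 9 * v ^ 2)) :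
    IsStationary w v v p₁ p₂ p₃ ↔
      p₁ = Δ / (4 * w + Δ) ∧ p₂ = 2 * w / (4 * w + Δ) ∧ p₃ = 2 * w / (4 * w + Δ) := by
  rw [show 4 * w ^ 2 - 4 * w * v + 9 * v ^ 2 = (2 * w - 3 * v) ^ 2 + 8 * w * v by ring] at hΔ
  have hc : 0 < 8 * w * v := by positivity
  have hpos : 0 < Δ := hΔ ▸ add_sqrt_pos hc
  have hsq : Δ ^ 2 = 2 * (2 * w - 3 * v) * Δ + 8 * w * v := hΔ ▸ sq_add_sqrt hc
  constructor
  · rintro ⟨⟨h1, h2, h3⟩, hsum, e1, e2⟩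
    have hW : 0 < w * p₁ + v * p₂ + v * p₃ := by positivity
    have h23 : p₃ = p₂ := by
      have : (w * p₁ + v * p₂ + v * p₃) * (p₃ - p₂) = 0 := by linear_combination e2
      rcases mul_eq_zero.1 this with h | h <;> linarith
    subst h23
    -- With p₂ = p₃ the remaining equation is quadratic in p₁ / p₃; the factor 2w normalizes it to
    -- the form of `Δ`.
    have hδ : 2 * w * p₁ / p₃ = Δ := by
      rw [hΔ]
      refine eq_add_sqrt_of_sq_eq (by positivity) hc ?_
      field_simp
      linear_combination (-4 : ℝ) * e1
    have hp1 : 2 * w * p₁ = Δ * p₃ := by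
      rw [← hδ]
      field_simp
    have h4 : p₃ = 2 * w / (4 * w + Δ) := by
      rw [eq_div_iff (by positivity)]
      linear_combination 2 * w * hsum - hp1
    refine ⟨?_, h4, h4⟩
    rw [eq_div_iff (by positivity)]
    linear_combination Δ * hsum + 2 * hp1
  · rintro ⟨rfl, rfl, rfl⟩
    refine ⟨⟨by positivity, by positivity, by positivity⟩, ?_, ?_, ?_⟩
    · field_simp
      ring
    · field_simp
      linear_combination (-w) * hsq
    · ring

theorem isStationary_iff_of_eq_left {w v p₁ p₂ p₃ Δ : ℝ} (hw : 0 < w) (hv : 0 < v)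
    (hΔ : Δ = 3 * w - 2 * v + √(9 * w ^ 2 - 4 * w * v + 4 * v ^ 2)) :
    IsStationary w w v p₁ p₂ p₃ ↔ p₁ = Δ / (2 * (Δ + 2 * w)) ∧ p₂ = Δ / (2 * (Δ + 2 * w)) ∧
      p₃ = 2 * w / (Δ + 2 * w) := by
  rw [show 9 * w ^ 2 - 4 * w * v + 4 * v ^ 2 = (3 * w - 2 * v) ^ 2 + 8 * w * v by ring] at hΔ
  have hc : 0 < 8 * w * v := by positivity
  have hpos : 0 < Δ := hΔ ▸ add_sqrt_pos hc
  have hsq : Δ ^ 2 = 2 * (3 * w - 2 * v) * Δ + 8 * w * v := hΔ ▸ sq_add_sqrt hc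
  constructor
  · rintro ⟨⟨h1, h2, h3⟩, hsum, e1, e2⟩
    have h12 : p₂ = p₁ := by
      -- If the first factor vanished, `e1` would force (w p₁ + w p₂ + v p₃) p₃ = 0, which is
      -- impossible for positive entries.
      have : (w * p₁ + w * p₂ + v * p₃ - (w - v) * p₃) * (p₂ - p₁) = 0 := by
        linear_combination e1 - e2
      rcases mul_eq_zero.1 this with h | h
      · have h' : (w * p₁ + w * p₂ + v * p₃ - (w - v) * p₃) * p₁ = 0 := by rw [h, zero_mul]
        have : (w * p₁ + w * p₂ + v * p₃) * p₃ = 0 := by linear_combination e1 + h'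
        have : 0 < (w * p₁ + w * p₂ + v * p₃) * p₃ := by positivity
        linarith
      · linarith
    subst h12
    have hδ : 4 * w * p₂ / p₃ = Δ := by
      rw [hΔ]
      refine eq_add_sqrt_of_sq_eq (by positivity) hc ?_
      field_simp
      linear_combination (-8 : ℝ) * e1
    have hp1 : 4 * w * p₂ = Δ * p₃ := by
      rw [← hδ]
      field_simp
    have h4 : p₂ = Δ / (2 * (Δ + 2 * w)) := by
      rw [eq_div_iff (by positivity)]
      linear_combination Δ * hsum + hp1
    refine ⟨h4, h4, ?_⟩
    rw [eq_div_iff (by positivity)]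
    linear_combination 2 * w * hsum - hp1
  · rintro ⟨rfl, rfl, rfl⟩
    refine ⟨⟨by positivity, by positivity, by positivity⟩, ?_, ?_, ?_⟩
    · field_simp
      ring
    · field_simp
      linear_combination (-2 * w) * hsq
    · field_simp
      linear_combination (-2 * w) * hsq

/-! ### Distinct weights and the cubic for p₁ / p₃. -/

/-- The cubic whose positive root is `p₁ / p₃`. -/
def ratioCubic (w₁ w₂ w₃ y : ℝ) : ℝ :=
  w₃ * (w₂ - w₃) + (3 * w₁ * w₂ - w₁ * w₃ - 4 * w₂ * w₃ + 2 * w₃ ^ 2) * y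
    + (2 * w₁ ^ 2 - 4 * w₁ * w₂ - w₁ * w₃ + 3 * w₂ * w₃) * y ^ 2 + w₁ * (w₂ - w₁) * y ^ 3

/-- The origin of the cubic: the first stationarity equation with p₃ scaled to 1, with y₂ eliminated
and its denominator cleared. -/
theorem ratioCubic_eq (w₁ w₂ w₃ y : ℝ) :
    ratioCubic w₁ w₂ w₃ y =
      (1 - y) * ((w₁ * y + w₃) * ((w₂ - w₃) + (w₁ - w₂) * y) + w₂ * (w₁ - w₃) * y)
        + (w₁ - w₃) * y * ((w₂ - w₃) + (w₁ - w₂) * y) := by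
  rw [ratioCubic]
  ring

/-- The monic cubic is positive at some -t < 0, negative at 0 and 1, and positive far to the right.
So it has one root s > 1 and two distinct negative roots; Cardano's value is the largest root, hence
s. -/
theorem exists_cardanoY_eq {w₁ w₂ w₃ : ℝ} (h₁₂ : w₂ < w₁) (h₂₃ : w₃ < w₂) (h₃ : 0 < w₃) :
    ∃ s : ℝ, 0 < s ∧ cardanoY w₁ w₂ w₃ = s ∧
      ∀ r, 0 < r → (ratioCubic w₁ w₂ w₃ r = 0 ↔ r = s) := by
  set c₀ : ℝ := w₃ * (w₂ - w₃) with hc₀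
  set c₁ : ℝ := 3 * w₁ * w₂ - w₁ * w₃ - 4 * w₂ * w₃ + 2 * w₃ ^ 2 with hc₁
  set c₂ : ℝ := 2 * w₁ ^ 2 - 4 * w₁ * w₂ - w₁ * w₃ + 3 * w₂ * w₃ with hc₂
  set c₃ : ℝ := w₁ * (w₂ - w₁) with hc₃
  have hcub : ∀ y, ratioCubic w₁ w₂ w₃ y = c₀ + c₁ * y + c₂ * y ^ 2 + c₃ * y ^ 3 := fun y => rfl
  have hc₃neg : c₃ < 0 := mul_neg_of_pos_of_neg (by linarith) (by linarith)
  have hc₀pos : 0 < c₀ := mul_pos h₃ (by linarith)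
  obtain ⟨b₀, hb₀⟩ : ∃ b, b = c₀ / c₃ := ⟨_, rfl⟩
  obtain ⟨b₁, hb₁⟩ : ∃ b, b = c₁ / c₃ := ⟨_, rfl⟩
  obtain ⟨b₂, hb₂⟩ : ∃ b, b = c₂ / c₃ := ⟨_, rfl⟩
  have hmon : ∀ y, ratioCubic w₁ w₂ w₃ y = c₃ * (y ^ 3 + b₂ * y ^ 2 + b₁ * y + b₀) := fun y => by
    rw [hcub, hb₀, hb₁, hb₂]
    field_simp [hc₃neg.ne]
    ring
  have hone : 1 ^ 3 + b₂ * 1 ^ 2 + b₁ * 1 + b₀ < 0 := by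
    have h1 : 0 < ratioCubic w₁ w₂ w₃ 1 := by
      have : ratioCubic w₁ w₂ w₃ 1 = (w₁ - w₃) ^ 2 := by
        rw [ratioCubic]
        ring
      rw [this]
      have : 0 < w₁ - w₃ := by linarith
      positivity
    rw [hmon] at h1
    exact (neg_iff_neg_of_mul_pos h1).1 hc₃neg
  obtain ⟨t, ht, htneg⟩ : ∃ t : ℝ, 0 < t ∧
      0 < (-t) ^ 3 + b₂ * (-t) ^ 2 + b₁ * (-t) + b₀ := by
    have h12 : 0 < w₁ - w₂ := by linarith
    have h23 : 0 < w₂ - w₃ := by linarith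
    -- -t is the zero of the denominator of y₂, where only one term of `ratioCubic_eq` survives.
    refine ⟨(w₂ - w₃) / (w₁ - w₂), by positivity, ?_⟩
    have hd : (w₂ - w₃) + (w₁ - w₂) * -((w₂ - w₃) / (w₁ - w₂)) = 0 := by
      field_simp
      ring
    have h1 : ratioCubic w₁ w₂ w₃ (-((w₂ - w₃) / (w₁ - w₂))) < 0 := by
      rw [ratioCubic_eq, hd]
      have : 0 < (1 + (w₂ - w₃) / (w₁ - w₂)) * (w₂ * (w₁ - w₃) * ((w₂ - w₃) / (w₁ - w₂))) := by
        have : 0 < w₁ - w₃ := by linarith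
        have : 0 < w₂ := by linarith
        positivity
      linarith
    rw [hmon] at h1
    by_contra! h2
    exact absurd (mul_nonneg_of_nonpos_of_nonpos hc₃neg.le h2) (by linarith)
  obtain ⟨s, hs1, hs⟩ : ∃ s : ℝ, 1 < s ∧ s ^ 3 + b₂ * s ^ 2 + b₁ * s + b₀ = 0 := by
    have hcont : Continuous fun y : ℝ => y ^ 3 + b₂ * y ^ 2 + b₁ * y + b₀ := by fun_prop
    -- Cauchy's bound for the roots of a monic polynomial.
    set K : ℝ := 1 + |b₂| + |b₁| + |b₀| with hK
    have hK1 : 1 ≤ K := by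
      have := abs_nonneg b₂
      have := abs_nonneg b₁
      have := abs_nonneg b₀
      linarith
    have hKpos : 0 ≤ K ^ 3 + b₂ * K ^ 2 + b₁ * K + b₀ := by
      have k1 : K ≤ K ^ 2 := by nlinarith
      have e2 : -|b₂| * K ^ 2 ≤ b₂ * K ^ 2 :=
        mul_le_mul_of_nonneg_right (neg_abs_le b₂) (by positivity)
      have e1 : -|b₁| * K ≤ b₁ * K :=
        mul_le_mul_of_nonneg_right (neg_abs_le b₁) (by positivity)
      have e1' : |b₁| * K ≤ |b₁| * K ^ 2 := mul_le_mul_of_nonneg_left k1 (abs_nonneg _)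
      have e0 : |b₀| * 1 ≤ |b₀| * K ^ 2 :=
        mul_le_mul_of_nonneg_left (by linarith) (abs_nonneg _)
      have : K ^ 3 = K ^ 2 + |b₂| * K ^ 2 + |b₁| * K ^ 2 + |b₀| * K ^ 2 := by
        rw [hK]
        ring
      nlinarith [neg_abs_le b₀, sq_nonneg K]
    obtain ⟨s, hs, hs0⟩ := intermediate_value_Icc hK1 hcont.continuousOn ⟨hone.le, hKpos⟩
    refine ⟨s, lt_of_le_of_ne hs.1 fun h => ?_, hs0⟩
    rw [← h] at hs0
    exact hone.ne hs0
  obtain ⟨B, hB⟩ : ∃ B, B = b₂ + s := ⟨_, rfl⟩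
  obtain ⟨C, hC⟩ : ∃ C, C = b₁ + s * B := ⟨_, rfl⟩
  have hfac : ∀ y, y ^ 3 + b₂ * y ^ 2 + b₁ * y + b₀ = (y - s) * (y ^ 2 + B * y + C) := fun y => by
    rw [hC, hB]
    linear_combination hs
  have hb₀neg : b₀ < 0 := hb₀ ▸ div_neg_of_pos_of_neg hc₀pos hc₃neg
  have hCpos : 0 < C := by
    have : s * C = -b₀ := by linear_combination hfac 0
    exact (pos_iff_pos_of_mul_pos (by linarith)).1 (by linarith : 0 < s)
  have hquad : t ^ 2 - B * t + C < 0 := by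
    rw [hfac] at htneg
    have : 0 < (t + s) * -(t ^ 2 - B * t + C) := by linarith
    linarith [(pos_iff_pos_of_mul_pos this).1 (by linarith)]
  have hBpos : 0 < B := by
    have : 0 < B * t := by linarith [sq_nonneg t]
    exact (pos_iff_pos_of_mul_pos this).2 ht
  have hroot : ∀ y, y ^ 3 + b₂ * y ^ 2 + b₁ * y + b₀ = 0 → y = s ∨ y < 0 := fun y hy => by
    rw [hfac] at hy
    rcases mul_eq_zero.1 hy with h | h
    · exact Or.inl (by linarith)
    · refine Or.inr ?_
      by_contra! hy0
      have : 0 < y ^ 2 + B * y + C := by positivity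
      linarith
  have hdisc : 27 * b₀ ^ 2 + 4 * b₁ ^ 3 - 18 * b₀ * b₁ * b₂ - b₁ ^ 2 * b₂ ^ 2
      + 4 * b₀ * b₂ ^ 3 < 0 := by
    -- The discriminant of (y - s)(y² + By + C) is the quadratic's discriminant times the square of
    -- the quadratic's value at s.
    have e : 27 * b₀ ^ 2 + 4 * b₁ ^ 3 - 18 * b₀ * b₁ * b₂ - b₁ ^ 2 * b₂ ^ 2
        + 4 * b₀ * b₂ ^ 3 = -((B ^ 2 - 4 * C) * (s ^ 2 + B * s + C) ^ 2) := by
      have e0 : b₀ = -(s * C) := by linear_combination hfac 0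
      have e1 : b₁ = C - s * B := by linarith
      have e2 : b₂ = B - s := by linarith
      rw [e0, e1, e2]
      ring
    have : 0 < B ^ 2 - 4 * C := by linarith [sq_nonneg (2 * t - B)]
    have : 0 < s ^ 2 + B * s + C := by positivity
    rw [e, neg_lt_zero]
    positivity
  obtain ⟨y, hy, hy0, hy1, hy2⟩ := cardano_formula_of_discr rfl hdisc rfl
  have hys : y = s := by
    refine (hroot y hy0).resolve_right fun hneg => ?_
    have hd : 0 < s - y := by linarith
    -- Taylor expansion of the cubic about y: to the right of the larger critical point it is
    -- increasing, so a negative y could not share the value 0 with s.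
    have : 0 < (s - y) * (3 * y ^ 2 + 2 * b₂ * y + b₁ + (s - y) * (3 * y + b₂)
        + (s - y) ^ 2) := by
      have : 0 < 3 * y ^ 2 + 2 * b₂ * y + b₁ := by linarith
      positivity
    linarith
  refine ⟨s, by linarith, ?_, fun r hr => ?_⟩
  · rw [← hys, ← hy, hb₀, hb₁, hb₂]
    rfl
  · rw [hmon, mul_eq_zero, or_iff_right hc₃neg.ne]
    refine ⟨fun h => (hroot r h).resolve_right (by linarith), ?_⟩
    rintro rfl
    exact hs

theorem isStationary_iff_ratioCubic {w₁ w₂ w₃ p₁ p₂ p₃ : ℝ} (h₁₂ : w₂ < w₁) (h₂₃ : w₃ < w₂)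
    (h₃ : 0 < w₃) : IsStationary w₁ w₂ w₃ p₁ p₂ p₃ ↔ ∃ y₁ y₂ : ℝ, 0 < y₁ ∧
      ratioCubic w₁ w₂ w₃ y₁ = 0 ∧ y₂ = (w₁ - w₃) * y₁ / ((w₂ - w₃) + (w₁ - w₂) * y₁) ∧
      p₁ = y₁ / (y₁ + y₂ + 1) ∧ p₂ = y₂ / (y₁ + y₂ + 1) ∧ p₃ = 1 / (y₁ + y₂ + 1) := by
  have k12 : 0 < w₁ - w₂ := by linarith
  have k23 : 0 < w₂ - w₃ := by linarith
  have k13 : 0 < w₁ - w₃ := by linarith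
  have k1 : 0 < w₁ := by linarith
  have k2 : 0 < w₂ := by linarith
  constructor
  · rintro ⟨⟨h1, h2, h3⟩, hsum, e1, e2⟩
    have hW : 0 < w₁ * p₁ + w₂ * p₂ + w₃ * p₃ := by positivity
    -- Eliminating W = w₁p₁ + w₂p₂ + w₃p₃ between the two equations gives y₂ as a function of y₁.
    have hrel : p₂ * ((w₂ - w₃) * p₃ + (w₁ - w₂) * p₁) = (w₁ - w₃) * p₁ * p₃ := by
      refine mul_left_cancel₀ hW.ne' ?_
      linear_combination (w₂ - w₃) * p₂ * e1 - (w₁ - w₃) * p₁ * e2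
    have hS : p₁ / p₃ + p₂ / p₃ + 1 = 1 / p₃ := by
      field_simp
      linarith
    refine ⟨p₁ / p₃, p₂ / p₃, by positivity, ?_, ?_, ?_, ?_, ?_⟩
    · rw [ratioCubic_eq]
      field_simp
      linear_combination ((w₂ - w₃) * p₃ + (w₁ - w₂) * p₁) * e1 - w₂ * (p₃ - p₁) * hrel
    · rw [eq_div_iff (by positivity)]
      field_simp
      linear_combination hrel
    all_goals
      rw [hS]
      field_simp
  · rintro ⟨y₁, y₂, hy, hcub, hy₂, rfl, rfl, rfl⟩
    have hd : 0 < (w₂ - w₃) + (w₁ - w₂) * y₁ := by positivity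
    have hy2 : 0 < y₂ := hy₂ ▸ by positivity
    have hrel : y₂ * ((w₂ - w₃) + (w₁ - w₂) * y₁) = (w₁ - w₃) * y₁ := by
      rw [hy₂]
      field_simp
    rw [ratioCubic_eq] at hcub
    have e1 : (w₁ * y₁ + w₂ * y₂ + w₃) * (1 - y₁) + (w₁ - w₃) * y₁ = 0 := by
      refine (mul_eq_zero.1 (?_ : ((w₂ - w₃) + (w₁ - w₂) * y₁) * _ = 0)).resolve_left hd.ne'
      linear_combination hcub + w₂ * (1 - y₁) * hrel
    have e2 : (w₁ * y₁ + w₂ * y₂ + w₃) * (1 - y₂) + (w₂ - w₃) * y₂ = 0 := by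
      refine (mul_eq_zero.1 (?_ : ((w₁ - w₃) * y₁) * _ = 0)).resolve_left (by positivity)
      linear_combination (w₂ - w₃) * y₂ * e1 - (w₁ * y₁ + w₂ * y₂ + w₃) * hrel
    refine ⟨⟨by positivity, by positivity, by positivity⟩, ?_, ?_, ?_⟩
    · field_simp
    · field_simp
      linear_combination e1
    · field_simp
      linear_combination e2

theorem isOrderedSolution_iff {w₁ w₂ w₃ p₁ p₂ p₃ : ℝ} (h₁ : 0 < w₁) (h₂ : 0 < w₂) (h₃ : 0 < w₃) :
    IsOrderedSolution w₁ w₂ w₃ p₁ p₂ p₃ ↔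
      (w₂ ≤ w₁ ∧ w₃ ≤ w₂) ∧ IsStationary w₁ w₂ w₃ p₁ p₂ p₃ := by
  have hcard : w₂ < w₁ → w₃ < w₂ → (IsStationary w₁ w₂ w₃ p₁ p₂ p₃ ↔
      let y₁ : ℂ := cardanoY w₁ w₂ w₃
      let y₂ : ℂ := ((w₁ - w₃ : ℝ) : ℂ) * y₁ / (((w₂ - w₃ : ℝ) : ℂ) + ((w₁ - w₂ : ℝ) : ℂ) * y₁)
      (p₁ : ℂ) = y₁ / (y₁ + y₂ + 1) ∧ (p₂ : ℂ) = y₂ / (y₁ + y₂ + 1) ∧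
        (p₃ : ℂ) = 1 / (y₁ + y₂ + 1)) := fun h₁₂ h₂₃ => by
    obtain ⟨s, hs, hcs, huniq⟩ := exists_cardanoY_eq h₁₂ h₂₃ h₃
    rw [isStationary_iff_ratioCubic h₁₂ h₂₃ h₃, hcs]
    dsimp only
    norm_cast
    constructor
    · rintro ⟨y₁, y₂, hy, hcub, rfl, h⟩
      obtain rfl := (huniq y₁ hy).1 hcub
      exact h
    · exact fun h => ⟨s, _, hs, (huniq s hs).2 rfl, rfl, h⟩
  rw [IsOrderedSolution]
  constructor
  · rintro (⟨h12, rfl, h⟩ | ⟨rfl, h23, h⟩ | ⟨h12, h23, h⟩)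
    · exact ⟨⟨h12, le_rfl⟩, (isStationary_iff_of_eq_right h₁ h₂ rfl).2 h⟩
    · exact ⟨⟨le_rfl, h23.le⟩, (isStationary_iff_of_eq_left h₁ h₃ rfl).2 h⟩
    · exact ⟨⟨h12.le, h23.le⟩, (hcard h12 h23).2 h⟩
  · rintro ⟨⟨h12, h23⟩, h⟩
    rcases h23.eq_or_lt with rfl | h23
    · exact Or.inl ⟨h12, rfl, (isStationary_iff_of_eq_right h₁ h₂ rfl).1 h⟩
    rcases h12.eq_or_lt with rfl | h12
    · exact Or.inr (Or.inl ⟨rfl, h23, (isStationary_iff_of_eq_left h₁ h₃ rfl).1 h⟩)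
    · exact Or.inr (Or.inr ⟨h12, h23, (hcard h12 h23).1 h⟩)

theorem isThreePointSolution_iff {w p : Fin 3 → ℝ} (hw : ∀ k, 0 < w k) :
    IsThreePointSolution w p ↔ IsStationary (w 0) (w 1) (w 2) (p 0) (p 1) (p 2) := by
  constructor
  · rintro ⟨σ, h⟩
    exact (isStationary_perm σ).1 ((isOrderedSolution_iff (hw _) (hw _) (hw _)).1 h).2
  · intro h
    -- Sorting the negated weights in increasing order puts the weights in decreasing order.
    have hanti := Tuple.monotone_sort fun k => -w k
    refine ⟨Tuple.sort fun k => -w k, (isOrderedSolution_iff (hw _) (hw _) (hw _)).2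
      ⟨⟨?_, ?_⟩, (isStationary_perm _).2 h⟩⟩
    · exact neg_le_neg_iff.1 (hanti (show (0 : Fin 3) ≤ 1 by decide))
    · exact neg_le_neg_iff.1 (hanti (show (1 : Fin 3) ≤ 2 by decide))

/-! ### Nonsingularity and the coefficients at the support points. -/

namespace Model
variable {m : ℕ} (M : Model m)

theorem X₁_mulVec_injective (hrank : M.X₁.rank = 3) {v : Fin 3 → ℝ} (hv : M.X₁ *ᵥ v = 0) :
    v = 0 := by
  have h := LinearMap.finrank_range_add_finrank_ker M.X₁.mulVecLin
  rw [show Module.finrank ℝ M.X₁.mulVecLin.range = 3 from hrank] at h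
  have hker : M.X₁.mulVecLin.ker = ⊥ := by
    rw [← Submodule.finrank_eq_zero (R := ℝ)]
    simpa using h
  have : v ∈ M.X₁.mulVecLin.ker := hv
  rwa [hker, Submodule.mem_bot] at this

/-- If all these minors vanished, `X₁` would annihilate the cross product of its rows `a` and `b`,
which is nonzero for distinct points. -/
theorem exists_minor_ne_zero (hrank : M.X₁.rank = 3) {a b : Fin m} (hab : M.x a ≠ M.x b) :
    ∃ i, M.minor a b i ≠ 0 := by
  by_contra! h
  have hv := M.X₁_mulVec_injective hrank
    (v := ![M.x a 0 * M.x b 1 - M.x a 1 * M.x b 0, M.x a 1 - M.x b 1, M.x b 0 - M.x a 0]) <| by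
    ext i
    have hi := h i
    rw [minor_eq_area, area] at hi
    simp [X₁, mulVec, dotProduct, Fin.sum_univ_three]
    linear_combination hi
  refine hab (funext fun k => ?_)
  fin_cases k
  · have := congrFun hv 2
    simp at this ⊢
    linarith
  · have := congrFun hv 1
    simp at this ⊢
    linarith

/-- The coefficient of a fourth point is positive when the first three points are collinear. -/
theorem detCoeff_pos_of_minor_eq_zero
    (hlink : ∀ γ ∈ Ioo (0 : ℝ) 1, DifferentiableAt ℝ M.link γ ∧ 0 < deriv M.link γ)
    (hwp : M.WellPosed) (hπ : ∀ i j, 0 < M.π i j ∧ M.π i j < 1)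
    {p : Fin m → ℝ} {a b c i : Fin m} (ha : 0 < p a) (hb : 0 < p b) (hc : 0 < p c)
    (habc : M.minor a b c = 0) (habi : M.minor a b i ≠ 0) : 0 < M.detCoeff p a b c i := by
  have he := M.e_pos hlink hwp hπ
  have hw := M.w_pos hlink hwp hπ
  have hew := M.e_mul_w_eq hlink hwp hπ
  -- This substitution separates a form with positive weights from a single perfect square.
  have hu : ∀ k, M.u₂ k = M.w k + M.f k ^ 2 / M.e k := fun k => by
    have := (he k).ne'
    field_simp
    linarith [hew k]
  have key : M.detCoeff p a b c i = M.e i *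
      ((M.minor a b i ^ 2 * (p a * M.e a) * (p b * M.e b)
        + M.minor a c i ^ 2 * (p a * M.e a) * (p c * M.e c)
        + M.minor b c i ^ 2 * (p b * M.e b) * (p c * M.e c))
        * (p a * M.w a + p b * M.w b + p c * M.w c)
      + p a * M.e a * (p b * M.e b) * (p c * M.e c)
        * (M.minor b c i * (M.f a / M.e a) - M.minor a c i * (M.f b / M.e b)
          + M.minor a b i * (M.f c / M.e c)) ^ 2) := by
    have := (he a).ne'
    have := (he b).ne'
    have := (he c).ne'
    rw [detCoeff, D_eq, M.minor_expansion a b c i, habc]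
    simp only [hu]
    field_simp
    ring
  rw [key]
  have := he a
  have := he b
  have := he c
  have := he i
  have := hw a
  have := hw b
  have := hw c
  positivity

/-- At a support point the coefficient is the partial derivative of `detThree` in that point's
weight; likewise for the other two points. -/
theorem detCoeff_first (p : Fin m → ℝ) (a b c : Fin m)
    (hew : ∀ k, M.e k * M.w k = M.e k * M.u₂ k - M.f k ^ 2) :
    M.detCoeff p a b c a = M.minor a b c ^ 2 * M.e a * M.e b * M.e c * p b * p c *
      (2 * M.w a * p a + M.w b * p b + M.w c * p c) := by
  have h1 : M.minor a b a = 0 := by simp only [minor_eq_area, area]; ring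
  have h2 : M.minor a c a = 0 := by simp only [minor_eq_area, area]; ring
  have h3 : M.minor b c a = M.minor a b c := by simp only [minor_eq_area, area]; ring
  rw [detCoeff, D_eq, h1, h2, h3]
  linear_combination (-2 * M.minor a b c ^ 2 * M.e b * M.e c * p a * p b * p c) * hew a

theorem detCoeff_second (p : Fin m → ℝ) (a b c : Fin m)
    (hew : ∀ k, M.e k * M.w k = M.e k * M.u₂ k - M.f k ^ 2) :
    M.detCoeff p a b c b = M.minor a b c ^ 2 * M.e a * M.e b * M.e c * p a * p c *
      (M.w a * p a + 2 * M.w b * p b + M.w c * p c) := by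
  have h1 : M.minor a b b = 0 := by simp only [minor_eq_area, area]; ring
  have h2 : M.minor b c b = 0 := by simp only [minor_eq_area, area]; ring
  have h3 : M.minor a c b = -M.minor a b c := by simp only [minor_eq_area, area]; ring
  rw [detCoeff, D_eq, h1, h2, h3]
  linear_combination (-2 * M.minor a b c ^ 2 * M.e a * M.e c * p a * p b * p c) * hew b

theorem detCoeff_third (p : Fin m → ℝ) (a b c : Fin m)
    (hew : ∀ k, M.e k * M.w k = M.e k * M.u₂ k - M.f k ^ 2) :
    M.detCoeff p a b c c = M.minor a b c ^ 2 * M.e a * M.e b * M.e c * p a * p b *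
      (M.w a * p a + M.w b * p b + 2 * M.w c * p c) := by
  have h1 : M.minor a c c = 0 := by simp only [minor_eq_area, area]; ring
  have h2 : M.minor b c c = 0 := by simp only [minor_eq_area, area]; ring
  rw [detCoeff, D_eq, h1, h2]
  linear_combination (-2 * M.minor a b c ^ 2 * M.e a * M.e b * p a * p b * p c) * hew c

section ThreePoint
variable {M}

theorem det_fisherInfo_three
    (hlink : ∀ γ ∈ Ioo (0 : ℝ) 1, DifferentiableAt ℝ M.link γ ∧ 0 < deriv M.link γ)
    (hwp : M.WellPosed) (hπ : ∀ i j, 0 < M.π i j ∧ M.π i j < 1)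
    {p : Fin m → ℝ} {a b c : Fin m} (hab : a ≠ b) (hac : a ≠ c) (hbc : b ≠ c)
    (hsupp : ∀ i, i ≠ a → i ≠ b → i ≠ c → p i = 0) :
    (M.fisherInfo p).det = M.detThree p a b c := by
  obtain ⟨R, hR⟩ := M.exists_det_fisherInfo_add_smul hlink hwp hπ hab hac hbc hsupp a
  simpa using hR 0

/-- Some design has a nonsingular information matrix. -/
theorem exists_det_fisherInfo_pos
    (hlink : ∀ γ ∈ Ioo (0 : ℝ) 1, DifferentiableAt ℝ M.link γ ∧ 0 < deriv M.link γ)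
    (hwp : M.WellPosed) (hπ : ∀ i j, 0 < M.π i j ∧ M.π i j < 1)
    (hrank : M.X₁.rank = 3) {a b : Fin m} (hab : M.x a ≠ M.x b) :
    ∃ q ∈ stdSimplex ℝ (Fin m), 0 < (M.fisherInfo q).det := by
  obtain ⟨i, hi⟩ := M.exists_minor_ne_zero hrank hab
  have hne : a ≠ b := fun h => hab (by rw [h])
  have hai : a ≠ i := by
    rintro rfl
    exact hi (by simp only [minor_eq_area, area]; ring)
  have hbi : b ≠ i := by
    rintro rfl
    exact hi (by simp only [minor_eq_area, area]; ring)
  have hq : ∀ k, k ≠ a → k ≠ b → k ≠ i →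
      (if k = a ∨ k = b ∨ k = i then (1 / 3 : ℝ) else 0) = 0 := fun k h1 h2 h3 => by
    simp [h1, h2, h3]
  refine ⟨fun k => if k = a ∨ k = b ∨ k = i then 1 / 3 else 0, ⟨fun k => ?_, ?_⟩, ?_⟩
  · dsimp only
    split_ifs <;> norm_num
  · have := sum_mul_eq hne hai hbi hq fun _ => 1
    simp only [mul_one] at this
    rw [this]
    norm_num
  · rw [det_fisherInfo_three hlink hwp hπ hne hai hbi hq, detThree]
    have := M.e_pos hlink hwp hπ a
    have := M.e_pos hlink hwp hπ b
    have := M.e_pos hlink hwp hπ i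
    have := M.w_pos hlink hwp hπ a
    have := M.w_pos hlink hwp hπ b
    have := M.w_pos hlink hwp hπ i
    simp only [true_or, or_true, if_true]
    positivity

/-- The general equivalence theorem for a nonsingular three-point design, in terms of the
coefficients of the determinant. -/
theorem isDOptimal_iff_detCoeff_le
    (hlink : ∀ γ ∈ Ioo (0 : ℝ) 1, DifferentiableAt ℝ M.link γ ∧ 0 < deriv M.link γ)
    (hwp : M.WellPosed) (hπ : ∀ i j, 0 < M.π i j ∧ M.π i j < 1)
    {p : Fin m → ℝ} (hp : p ∈ stdSimplex ℝ (Fin m)) {a b c : Fin m}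
    (hab : a ≠ b) (hac : a ≠ c) (hbc : b ≠ c)
    (hsupp : ∀ i, i ≠ a → i ≠ b → i ≠ c → p i = 0) (hpos : 0 < M.detThree p a b c) :
    M.IsDOptimal p ↔ ∀ i, M.detCoeff p a b c i ≤ 4 * M.detThree p a b c := by
  have hdet := det_fisherInfo_three hlink hwp hπ hab hac hbc hsupp
  rw [M.isDOptimal_iff_trace_le hπ hp (hdet ▸ hpos)]
  refine forall_congr' fun i => ?_
  obtain ⟨R, hR⟩ := M.exists_det_fisherInfo_add_smul hlink hwp hπ hab hac hbc hsupp i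
  rw [← hdet] at hR
  rw [← det_mul_trace_inv_mul_of_det_expansion (hdet ▸ hpos.ne') hR, hdet, mul_comm 4,
    mul_le_mul_iff_right₀ hpos]

end ThreePoint
end Model

/-! ### Optimality, stationarity and the off-support inequalities combined. -/

/-- Characterization of D-optimal designs supported on three points. -/
theorem isDOptimal_iff_isThreePointSolution (m : ℕ) (M : CumulativeLink.Model m)
    (hlink : ∀ γ ∈ Set.Ioo (0 : ℝ) 1, DifferentiableAt ℝ M.link γ ∧ 0 < deriv M.link γ)
    (hwp : M.WellPosed)
    (hπ : ∀ i j, 0 < M.π i j ∧ M.π i j < 1)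
    (hx : Function.Injective M.x)
    (hrank : M.X₁.rank = 3)
    (p : Fin m → ℝ) (hp : p ∈ stdSimplex ℝ (Fin m))
    {a b c : Fin m} (hab : a ≠ b) (hac : a ≠ c) (hbc : b ≠ c)
    (hsupp : ∀ i, i ≠ a → i ≠ b → i ≠ c → p i = 0) :
    M.IsDOptimal p ↔
      CumulativeLink.IsThreePointSolution ![M.w a, M.w b, M.w c] ![p a, p b, p c] ∧
      ∀ i, i ≠ a → i ≠ b → i ≠ c → M.detCoeff p a b c i
        ≤ M.minor a b c ^ 2 * M.e a * M.e b * M.e c * p b * p c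
            * (2 * M.w a * p a + M.w b * p b + M.w c * p c) := by
  have he := M.e_pos hlink hwp hπ
  have hw := M.w_pos hlink hwp hπ
  have hew := M.e_mul_w_eq hlink hwp hπ
  have hsum : p a + p b + p c = 1 := by
    have := Model.sum_mul_eq hab hac hbc hsupp fun _ => 1
    simpa [hp.2] using this.symm
  have hthree := Model.det_fisherInfo_three hlink hwp hπ hab hac hbc hsupp
  rw [isThreePointSolution_iff (by simp [Fin.forall_fin_succ, hw])]
  simp only [Matrix.cons_val_zero, Matrix.cons_val_one, Matrix.cons_val]
  rw [isStationary_iff]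
  constructor
  · intro hopt
    have hpos : 0 < M.detThree p a b c := by
      obtain ⟨q, hq, hqpos⟩ := Model.exists_det_fisherInfo_pos hlink hwp hπ hrank (hx.ne hab)
      rw [← hthree]
      exact hqpos.trans_le (hopt.2 q hq)
    have hcoef := (Model.isDOptimal_iff_detCoeff_le hlink hwp hπ hp hab hac hbc hsupp hpos).1 hopt
    have hne : p a ≠ 0 ∧ p b ≠ 0 ∧ p c ≠ 0 ∧ M.minor a b c ≠ 0 := by
      refine ⟨fun h => ?_, fun h => ?_, fun h => ?_, fun h => ?_⟩ <;>
        simp [Model.detThree, h] at hpos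
    have ha : 0 < p a := (hp.1 a).lt_of_ne' hne.1
    have hb : 0 < p b := (hp.1 b).lt_of_ne' hne.2.1
    have hc : 0 < p c := (hp.1 c).lt_of_ne' hne.2.2.1
    have hm := hne.2.2.2
    have hea := he a
    have heb := he b
    have hec := he c
    obtain ⟨K, hK⟩ : ∃ K, K = M.minor a b c ^ 2 * M.e a * M.e b * M.e c := ⟨_, rfl⟩
    have hKpos : 0 < K := by
      rw [hK]
      positivity
    obtain ⟨W, hW⟩ : ∃ W, W = M.w a * p a + M.w b * p b + M.w c * p c := ⟨_, rfl⟩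
    have h1 := hcoef a
    have h2 := hcoef b
    have h3 := hcoef c
    rw [M.detCoeff_first p a b c hew, Model.detThree, ← hK, ← hW] at h1
    rw [M.detCoeff_second p a b c hew, Model.detThree, ← hK, ← hW] at h2
    rw [M.detCoeff_third p a b c hew, Model.detThree, ← hK, ← hW] at h3
    have s1 : W + M.w a * p a ≤ 4 * p a * W := by
      refine le_of_mul_le_mul_left ?_ (show 0 < K * p b * p c by positivity)
      rw [hW] at h1 ⊢
      linarith
    have s2 : W + M.w b * p b ≤ 4 * p b * W := by
      refine le_of_mul_le_mul_left ?_ (show 0 < K * p a * p c by positivity)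
      rw [hW] at h2 ⊢
      linarith
    have s3 : W + M.w c * p c ≤ 4 * p c * W := by
      refine le_of_mul_le_mul_left ?_ (show 0 < K * p a * p b by positivity)
      rw [hW] at h3 ⊢
      linarith
    -- The left sides of `s1`, `s2`, `s3` also add up to 4W, so all three inequalities are
    -- equalities.
    have htot : 4 * p a * W + 4 * p b * W + 4 * p c * W = 4 * W := by
      linear_combination 4 * W * hsum
    have t1 : W + M.w a * p a = 4 * p a * W := by linarith
    refine ⟨⟨⟨ha, hb, hc⟩, hsum, ?_, ?_, ?_⟩, fun i _ _ _ => (hcoef i).trans_eq ?_⟩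
    · rw [← hW]
      exact t1
    · rw [← hW]
      linarith
    · rw [← hW]
      linarith
    · rw [Model.detThree, ← hK, ← hW]
      linear_combination (-K * p b * p c) * t1 + K * p b * p c * hW
  · rintro ⟨⟨⟨ha, hb, hc⟩, -, t1, t2, t3⟩, hle⟩
    -- Noncollinearity is not assumed: were the minor zero, the right side of `hle` would vanish
    -- while a point off the line has a positive coefficient.
    have hm : M.minor a b c ≠ 0 := fun hm => by
      obtain ⟨i, hi⟩ := M.exists_minor_ne_zero hrank (hx.ne hab)
      have hpos := M.detCoeff_pos_of_minor_eq_zero hlink hwp hπ ha hb hc hm hi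
      have hneg := hle i (by rintro rfl; exact hi (by simp only [Model.minor_eq_area, area]; ring))
        (by rintro rfl; exact hi (by simp only [Model.minor_eq_area, area]; ring))
        (by rintro rfl; exact hi hm)
      rw [hm] at hneg
      linarith
    have hea := he a
    have heb := he b
    have hec := he c
    have hwa := hw a
    have hwb := hw b
    have hwc := hw c
    have hpos : 0 < M.detThree p a b c := by
      rw [Model.detThree]
      positivity
    rw [Model.isDOptimal_iff_detCoeff_le hlink hwp hπ hp hab hac hbc hsupp hpos]
    obtain ⟨K, hK⟩ : ∃ K, K = M.minor a b c ^ 2 * M.e a * M.e b * M.e c := ⟨_, rfl⟩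
    intro i
    by_cases hia : i = a
    · subst hia
      rw [M.detCoeff_first p _ b c hew, Model.detThree, ← hK]
      exact le_of_eq (by linear_combination K * p b * p c * t1)
    by_cases hib : i = b
    · subst hib
      rw [M.detCoeff_second p a _ c hew, Model.detThree, ← hK]
      exact le_of_eq (by linear_combination K * p a * p c * t2)
    by_cases hic : i = c
    · subst hic
      rw [M.detCoeff_third p a b _ hew, Model.detThree, ← hK]
      exact le_of_eq (by linear_combination K * p a * p b * t3)
    -- By `t1` the right side of condition (2) is 4 `detThree`; its apparent preference for the
    -- first point is only notational.
    refine (hle i hia hib hic).trans_eq ?_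
    rw [Model.detThree, ← hK]
    linear_combination K * p b * p c * t1

end CumulativeLink

end

theorem mainTheorem12 (m : ℕ) (hm : 4 ≤ m) (M : CumulativeLink.Model m)
    (hlink : ∀ γ ∈ Set.Ioo (0 : ℝ) 1, DifferentiableAt ℝ M.link γ ∧ 0 < deriv M.link γ)
    (hwp : M.WellPosed)
    (hπ : ∀ i j, 0 < M.π i j ∧ M.π i j < 1)
    (hx : Function.Injective M.x)
    (hrank : M.X₁.rank = 3)
    (p : Fin m → ℝ) (hp : p ∈ stdSimplex ℝ (Fin m))
    (hsupp : ∀ i : Fin m, 3 ≤ (i : ℕ) → p i = 0)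
    (a b c : Fin m) (ha : (a : ℕ) = 0) (hb : (b : ℕ) = 1) (hc : (c : ℕ) = 2) :
    M.IsDOptimal p ↔
      CumulativeLink.IsThreePointSolution ![M.w a, M.w b, M.w c] ![p a, p b, p c] ∧
      ∀ i : Fin m, 3 ≤ (i : ℕ) →
        M.minor a b i ^ 2 * M.e a * M.e b * M.e i * p a * p b * (M.w a * p a + M.w b * p b)
          + M.minor a c i ^ 2 * M.e a * M.e c * M.e i * p a * p c * (M.w a * p a + M.w c * p c)
          + M.minor b c i ^ 2 * M.e b * M.e c * M.e i * p b * p c * (M.w b * p b + M.w c * p c)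
          + M.D a b c i * p a * p b * p c
        ≤ M.minor a b c ^ 2 * M.e a * M.e b * M.e c * p b * p c
            * (2 * M.w a * p a + M.w b * p b + M.w c * p c) := by
  have hge : ∀ i : Fin m, 3 ≤ (i : ℕ) ↔ i ≠ a ∧ i ≠ b ∧ i ≠ c := fun i => by
    simp only [ne_eq, Fin.ext_iff]
    omega
  have hne : a ≠ b ∧ a ≠ c ∧ b ≠ c := by
    simp only [ne_eq, Fin.ext_iff]
    omega
  rw [CumulativeLink.isDOptimal_iff_isThreePointSolution m M hlink hwp hπ hx hrank p hp hne.1 hne.2.1 hne.2.2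
    fun i h1 h2 h3 => hsupp i ((hge i).2 ⟨h1, h2, h3⟩)]
  simp only [hge, and_imp, CumulativeLink.Model.detCoeff]
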